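/- **Corollary 5.3** (unbounded semigroup, Neumann case). Let $X=H^1(-1,0)\times L^2(-1,0)\times L^2(0,\infty)$ (complex-valued functions) with its natural Hilbert space norm $\|(u,v,w)\|^2=\|u\|_{L^2}^2+\|u'\|_{L^2}^2+\|v\|_{L^2}^2+\|w\|_{L^2}^2$, and let $A$ be the operator on $X$ defined by $A(u,v,w)=(v,u'',w'')$ on the domain $$D(A)=\big\{(u,v,w)\in H^2(-1,0)\times H^1(-1,0)\times H^2(0,\infty):\ u'(-1)=0,\ u'(0)=w'(0),\ v(0)=w(0)\big\}.$$ Then $A$ is the generator of a $C_0$-semigroup $(T(t))_{t\ge 0}$ on $X$, and this semigroup is unbounded, i.e. $\sup_{t\ge0}\|T(t)\|=\infty$. Moreover $\operatorname{Ker}(A)=\operatorname{span}\{(1,0,0)\}$ and $\operatorname{Ran}(A)$ is dense in $X$; in particular the splitting $X=\overline{\operatorname{Ran}(A)}\oplus\operatorname{Ker}(A)$ fails. -/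

import Mathlib

open MeasureTheory Topology Filter Set
open scoped ENNReal NNReal ContDiff

/-! ## Strongly continuous semigroups and their generators -/

/-- A `C₀`-semigroup of bounded linear operators on a complex normed space. -/
structure C0Semigroup (E : Type*) [NormedAddCommGroup E] [NormedSpace ℂ E] where
  /-- the operator `T(t)` -/
  op : ℝ≥0 → E →L[ℂ] E
  op_zero : op 0 = ContinuousLinearMap.id ℂ E
  op_add : ∀ s t : ℝ≥0, op (s + t) = (op s).comp (op t)
  strongly_continuous : ∀ x : E, Tendsto (fun t : ℝ≥0 => op t x) (𝓝[>] 0) (𝓝 x)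

namespace C0Semigroup

variable {E : Type*} [NormedAddCommGroup E] [NormedSpace ℂ E]

/-- The semigroup is bounded: `sup_{t ≥ 0} ‖T(t)‖ < ∞`. -/
def IsBounded (T : C0Semigroup E) : Prop :=
  ∃ M : ℝ, ∀ t : ℝ≥0, ‖T.op t‖ ≤ M

/-- `y = lim_{t ↓ 0} (T(t) x - x) / t`. -/
def HasGenValue (T : C0Semigroup E) (x y : E) : Prop :=
  Tendsto (fun t : ℝ≥0 => ((t : ℝ) : ℂ)⁻¹ • (T.op t x - x)) (𝓝[>] 0) (𝓝 y)

theorem HasGenValue.unique {T : C0Semigroup E} {x y z : E}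
    (h : T.HasGenValue x y) (h' : T.HasGenValue x z) : y = z :=
  tendsto_nhds_unique h h'

theorem HasGenValue.add {T : C0Semigroup E} {x y x' y' : E}
    (h : T.HasGenValue x y) (h' : T.HasGenValue x' y') :
    T.HasGenValue (x + x') (y + y') := by
  refine (Tendsto.add h h').congr fun t => ?_
  rw [map_add, ← smul_add]
  congr 1
  abel

theorem HasGenValue.smul {T : C0Semigroup E} {x y : E} (c : ℂ)
    (h : T.HasGenValue x y) : T.HasGenValue (c • x) (c • y) := by
  refine (Tendsto.const_smul h c).congr fun t => ?_
  rw [map_smul, ← smul_sub, smul_comm]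

/-- The (infinitesimal) generator of a `C₀`-semigroup: its domain consists of all `x` for which
`lim_{t ↓ 0} (T(t) x - x) / t` exists, and it maps `x` to this limit. -/
noncomputable def generator (T : C0Semigroup E) : E →ₗ.[ℂ] E where
  domain :=
    { carrier := {x | ∃ y, T.HasGenValue x y}
      add_mem' := fun ⟨_, h⟩ ⟨_, h'⟩ => ⟨_, h.add h'⟩
      zero_mem' := ⟨0, by simp [HasGenValue]⟩
      smul_mem' := fun c _ ⟨_, h⟩ => ⟨_, h.smul c⟩ }
  toFun :=
    { toFun := fun x => x.2.choose
      map_add' := fun x x' =>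
        (x + x').2.choose_spec.unique (x.2.choose_spec.add x'.2.choose_spec)
      map_smul' := fun c x => (c • x).2.choose_spec.unique (x.2.choose_spec.smul c) }

end C0Semigroup

namespace WaveHeat

/-- The kernel `{x ∈ D(A) : A x = 0}` of a partially defined operator, as a subspace of `E`. -/
def pmapKer {E F : Type*} [AddCommGroup E] [Module ℂ E] [AddCommGroup F] [Module ℂ F]
    (A : E →ₗ.[ℂ] F) : Submodule ℂ E :=
  (LinearMap.ker A.toFun).map A.domain.subtype

/-- The range `{A x : x ∈ D(A)}` of a partially defined operator. -/
def pmapRan {E F : Type*} [AddCommGroup E] [Module ℂ E] [AddCommGroup F] [Module ℂ F]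
    (A : E →ₗ.[ℂ] F) : Submodule ℂ F :=
  LinearMap.range A.toFun

/-! ## Weak derivatives and Sobolev functions on an open subset of the line -/

/-- The complex Hilbert space `L²(Ω)`. -/
abbrev L2 (Ω : TopologicalSpace.Opens ℝ) : Type :=
  Lp ℂ 2 (volume.restrict (Ω : Set ℝ))

/-- `g` is the weak derivative of `f` on `Ω`: `∫_Ω φ' f = - ∫_Ω φ g` for `φ ∈ C_c^∞(Ω)`. -/
def IsWeakDeriv {Ω : TopologicalSpace.Opens ℝ} (f g : L2 Ω) : Prop :=
  ∀ φ : ℝ → ℝ, ContDiff ℝ ∞ φ → HasCompactSupport φ → tsupport φ ⊆ (Ω : Set ℝ) →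
    ∫ x in (Ω : Set ℝ), deriv φ x • f x = - ∫ x in (Ω : Set ℝ), φ x • g x

theorem integrable_test_smul {Ω : TopologicalSpace.Opens ℝ} {φ : ℝ → ℝ} (hc : Continuous φ)
    (hs : HasCompactSupport φ) (f : L2 Ω) :
    Integrable (fun x => φ x • f x) (volume.restrict (Ω : Set ℝ)) := by
  have h1 : MemLp φ 2 (volume.restrict (Ω : Set ℝ)) :=
    (hc.memLp_of_hasCompactSupport (μ := volume) hs).restrict _
  exact memLp_one_iff_integrable.1 ((Lp.memLp f).smul h1)

theorem IsWeakDeriv.add {Ω : TopologicalSpace.Opens ℝ} {f g f' g' : L2 Ω}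
    (h : IsWeakDeriv f g) (h' : IsWeakDeriv f' g') : IsWeakDeriv (f + f') (g + g') := by
  intro φ hφ hs hΩ
  have hd : Continuous (deriv φ) := hφ.continuous_deriv (by simp)
  have e1 : (fun x => deriv φ x • (f + f') x) =ᵐ[volume.restrict (Ω : Set ℝ)]
      fun x => deriv φ x • f x + deriv φ x • f' x := by
    filter_upwards [Lp.coeFn_add f f'] with x hx
    rw [hx, Pi.add_apply, smul_add]
  have e2 : (fun x => φ x • (g + g') x) =ᵐ[volume.restrict (Ω : Set ℝ)]
      fun x => φ x • g x + φ x • g' x := by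
    filter_upwards [Lp.coeFn_add g g'] with x hx
    rw [hx, Pi.add_apply, smul_add]
  rw [integral_congr_ae e1, integral_congr_ae e2,
    integral_add (integrable_test_smul hd hs.deriv f) (integrable_test_smul hd hs.deriv f'),
    integral_add (integrable_test_smul hφ.continuous hs g)
      (integrable_test_smul hφ.continuous hs g'), h φ hφ hs hΩ, h' φ hφ hs hΩ, neg_add]

theorem IsWeakDeriv.smul {Ω : TopologicalSpace.Opens ℝ} {f g : L2 Ω} (c : ℂ)
    (h : IsWeakDeriv f g) : IsWeakDeriv (c • f) (c • g) := by
  intro φ hφ hs hΩ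
  have e1 : (fun x => deriv φ x • (c • f) x) =ᵐ[volume.restrict (Ω : Set ℝ)]
      fun x => c • (deriv φ x • f x) := by
    filter_upwards [Lp.coeFn_smul c f] with x hx
    rw [hx, Pi.smul_apply, smul_comm]
  have e2 : (fun x => φ x • (c • g) x) =ᵐ[volume.restrict (Ω : Set ℝ)]
      fun x => c • (φ x • g x) := by
    filter_upwards [Lp.coeFn_smul c g] with x hx
    rw [hx, Pi.smul_apply, smul_comm]
  rw [integral_congr_ae e1, integral_congr_ae e2, integral_smul, integral_smul,
    h φ hφ hs hΩ, smul_neg]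

theorem IsWeakDeriv.zero {Ω : TopologicalSpace.Opens ℝ} : IsWeakDeriv (0 : L2 Ω) 0 := by
  intro φ hφ hs hΩ
  have e1 : (fun x => deriv φ x • (0 : L2 Ω) x) =ᵐ[volume.restrict (Ω : Set ℝ)] 0 := by
    filter_upwards [Lp.coeFn_zero ℂ 2 (volume.restrict (Ω : Set ℝ))] with x hx
    rw [hx]; simp
  have e2 : (fun x => φ x • (0 : L2 Ω) x) =ᵐ[volume.restrict (Ω : Set ℝ)] 0 := by
    filter_upwards [Lp.coeFn_zero ℂ 2 (volume.restrict (Ω : Set ℝ))] with x hx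
    rw [hx]; simp
  rw [integral_congr_ae e1, integral_congr_ae e2]
  simp

theorem IsWeakDeriv.unique {Ω : TopologicalSpace.Opens ℝ} {f g g' : L2 Ω}
    (h : IsWeakDeriv f g) (h' : IsWeakDeriv f g') : g = g' := by
  have h0 : IsWeakDeriv (0 : L2 Ω) (g - g') := by
    have := h.add (h'.smul (-1))
    simpa [sub_eq_add_neg] using this
  have hz : ∀ᵐ x ∂(volume : Measure ℝ), x ∈ (Ω : Set ℝ) → (g - g' : L2 Ω) x = 0 := by
    refine Ω.isOpen.ae_eq_zero_of_integral_contDiff_smul_eq_zero ?_ ?_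
    · have hl : LocallyIntegrable (g - g' : L2 Ω) (volume.restrict (Ω : Set ℝ)) :=
        (Lp.memLp (g - g')).locallyIntegrable (by norm_num)
      intro x hx
      obtain ⟨U, hU, hi⟩ := hl x
      refine ⟨U ∩ Ω, inter_mem (mem_nhdsWithin_of_mem_nhds hU) self_mem_nhdsWithin, ?_⟩
      rwa [IntegrableOn, Measure.restrict_restrict' Ω.isOpen.measurableSet] at hi
    · intro φ hφ hs hΩ
      have e1 : (fun x => deriv φ x • (0 : L2 Ω) x) =ᵐ[volume.restrict (Ω : Set ℝ)] 0 := by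
        filter_upwards [Lp.coeFn_zero ℂ 2 (volume.restrict (Ω : Set ℝ))] with x hx
        rw [hx]; simp
      have := h0 φ hφ hs hΩ
      rw [integral_congr_ae e1] at this
      rw [← setIntegral_eq_integral_of_forall_compl_eq_zero (s := (Ω : Set ℝ))]
      · simpa using this.symm
      · intro x hx
        rw [image_eq_zero_of_notMem_tsupport (fun hx' => hx (hΩ hx')), zero_smul]
  rw [← sub_eq_zero]
  apply Lp.ext
  have := (ae_restrict_iff' Ω.isOpen.measurableSet).2 hz
  filter_upwards [this, Lp.coeFn_zero ℂ 2 (volume.restrict (Ω : Set ℝ))] with x hx hx'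
  rw [hx, hx']; rfl

open Classical in
/-- The weak derivative `f'` of `f`, if it exists in `L²(Ω)` (and `0` otherwise; only used for
functions whose weak derivative exists in `L²(Ω)`). -/
noncomputable def weakDeriv {Ω : TopologicalSpace.Opens ℝ} (f : L2 Ω) : L2 Ω :=
  if h : ∃ g, IsWeakDeriv f g then h.choose else 0

theorem IsWeakDeriv.weakDeriv_eq {Ω : TopologicalSpace.Opens ℝ} {f g : L2 Ω}
    (h : IsWeakDeriv f g) : weakDeriv f = g := by
  have h' : ∃ g, IsWeakDeriv f g := ⟨g, h⟩
  rw [weakDeriv, dif_pos h']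
  exact h'.choose_spec.unique h

/-- The complex Hilbert space `H¹(Ω)`, realised as the space of all pairs `(f, f')` with
`f ∈ L²(Ω)` and weak derivative `f' ∈ L²(Ω)`. The norm is the natural one,
`‖f‖² = ‖f‖²_{L²} + ‖f'‖²_{L²}`. -/
def H1 (Ω : TopologicalSpace.Opens ℝ) : Submodule ℂ (WithLp 2 (L2 Ω × L2 Ω)) where
  carrier := {z | IsWeakDeriv z.fst z.snd}
  add_mem' := fun h h' => IsWeakDeriv.add h h'
  zero_mem' := IsWeakDeriv.zero
  smul_mem' := fun c _ h => IsWeakDeriv.smul c h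

/-- The element of `H¹(Ω)` given by a function `f` and its weak derivative `g`. -/
def H1.mk {Ω : TopologicalSpace.Opens ℝ} (f g : L2 Ω) (h : IsWeakDeriv f g) : H1 Ω :=
  ⟨WithLp.toLp 2 (f, g), h⟩

theorem H1.mk_add {Ω : TopologicalSpace.Opens ℝ} {f g f' g' : L2 Ω} (h : IsWeakDeriv f g)
    (h' : IsWeakDeriv f' g') :
    H1.mk f g h + H1.mk f' g' h' = H1.mk (f + f') (g + g') (h.add h') := by
  apply Subtype.ext
  rfl

theorem H1.mk_smul {Ω : TopologicalSpace.Opens ℝ} {f g : L2 Ω} (k : ℂ) (h : IsWeakDeriv f g) :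
    k • H1.mk f g h = H1.mk (k • f) (k • g) (h.smul k) := by
  apply Subtype.ext
  rfl

/-- The function underlying an element of `H¹(Ω)`. -/
def H1.fn {Ω : TopologicalSpace.Opens ℝ} (u : H1 Ω) : L2 Ω := u.1.fst

/-- The weak derivative of an element of `H¹(Ω)`. -/
def H1.der {Ω : TopologicalSpace.Opens ℝ} (u : H1 Ω) : L2 Ω := u.1.snd

/-- `f ∈ L²(Ω)` has a representative that is continuous on the closure of `Ω` and takes the
value `c` at the point `a`. For an interval `Ω`, an endpoint `a` of `Ω` and `f ∈ H¹(Ω)` this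
expresses `f(a) = c`. -/
def HasBoundaryValue {Ω : TopologicalSpace.Opens ℝ} (f : L2 Ω) (a : ℝ) (c : ℂ) : Prop :=
  ∃ F : ℝ → ℂ, ContinuousOn F (closure (Ω : Set ℝ)) ∧
    (f : ℝ → ℂ) =ᵐ[volume.restrict (Ω : Set ℝ)] F ∧ F a = c

theorem HasBoundaryValue.add {Ω : TopologicalSpace.Opens ℝ} {f g : L2 Ω} {a : ℝ} {c d : ℂ}
    (h : HasBoundaryValue f a c) (h' : HasBoundaryValue g a d) :
    HasBoundaryValue (f + g) a (c + d) := by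
  obtain ⟨F, hF, hf, rfl⟩ := h
  obtain ⟨G, hG, hg, rfl⟩ := h'
  exact ⟨F + G, hF.add hG, (Lp.coeFn_add f g).trans (hf.add hg), rfl⟩

theorem HasBoundaryValue.smul {Ω : TopologicalSpace.Opens ℝ} {f : L2 Ω} {a : ℝ} {c : ℂ}
    (k : ℂ) (h : HasBoundaryValue f a c) : HasBoundaryValue (k • f) a (k • c) := by
  obtain ⟨F, hF, hf, rfl⟩ := h
  exact ⟨k • F, hF.const_smul k, (Lp.coeFn_smul k f).trans (hf.const_smul k), rfl⟩

theorem HasBoundaryValue.zero {Ω : TopologicalSpace.Opens ℝ} {a : ℝ} :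
    HasBoundaryValue (0 : L2 Ω) a 0 :=
  ⟨0, continuousOn_const, Lp.coeFn_zero ℂ 2 _, rfl⟩

/-! ## The wave-heat operator with a Neumann condition at `ξ = -1` -/

/-- The wave interval `(-1, 0)`. -/
def waveI : TopologicalSpace.Opens ℝ := ⟨Ioo (-1) 0, isOpen_Ioo⟩

/-- The heat half-line `(0, ∞)`. -/
def heatI : TopologicalSpace.Opens ℝ := ⟨Ioi 0, isOpen_Ioi⟩

/-- `X = H¹(-1,0) × L²(-1,0) × L²(0,∞)` with its natural Hilbert space norm. -/
abbrev X : Type := WithLp 2 (H1 waveI × WithLp 2 (L2 waveI × L2 heatI))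

/-- The displacement `u ∈ H¹(-1,0)` of `x = (u, v, w)`. -/
def X.u (x : X) : H1 waveI := x.fst

/-- The velocity `v ∈ L²(-1,0)` of `x = (u, v, w)`. -/
def X.v (x : X) : L2 waveI := x.snd.fst

/-- The heat profile `w ∈ L²(0,∞)` of `x = (u, v, w)`. -/
def X.w (x : X) : L2 heatI := x.snd.snd

/-- The element `(u, v, w)` of `X`. -/
def X.mk (u : H1 waveI) (v : L2 waveI) (w : L2 heatI) : X :=
  WithLp.toLp 2 (u, WithLp.toLp 2 (v, w))

theorem X.mk_add (u u' : H1 waveI) (v v' : L2 waveI) (w w' : L2 heatI) :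
    X.mk u v w + X.mk u' v' w' = X.mk (u + u') (v + v') (w + w') := rfl

theorem X.mk_smul (k : ℂ) (u : H1 waveI) (v : L2 waveI) (w : L2 heatI) :
    k • X.mk u v w = X.mk (k • u) (k • v) (k • w) := rfl

theorem X.v_add (x y : X) : X.v (x + y) = X.v x + X.v y := rfl

theorem X.v_smul (k : ℂ) (x : X) : X.v (k • x) = k • X.v x := rfl

/-- The conditions defining `D(A)`, for `x = (u, v, w)` with `u'' = p`, `v' = q`, `w' = r`,
`w'' = s`: these derivatives exist in `L²`, that is,
`(u, v, w) ∈ H²(-1,0) × H¹(-1,0) × H²(0,∞)`, and `u'(-1) = 0`, `u'(0) = w'(0)`,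
`v(0) = w(0)`. -/
structure DomainData (x : X) (p q : L2 waveI) (r s : L2 heatI) : Prop where
  u_deriv2 : IsWeakDeriv (H1.der x.u) p
  v_deriv : IsWeakDeriv x.v q
  w_deriv : IsWeakDeriv x.w r
  w_deriv2 : IsWeakDeriv r s
  neumann : HasBoundaryValue (H1.der x.u) (-1) 0
  flux : ∃ c : ℂ, HasBoundaryValue (H1.der x.u) 0 c ∧ HasBoundaryValue r 0 c
  coupling : ∃ c : ℂ, HasBoundaryValue x.v 0 c ∧ HasBoundaryValue x.w 0 c

theorem DomainData.add {x x' : X} {p q p' q' : L2 waveI} {r s r' s' : L2 heatI}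
    (h : DomainData x p q r s) (h' : DomainData x' p' q' r' s') :
    DomainData (x + x') (p + p') (q + q') (r + r') (s + s') where
  u_deriv2 := h.u_deriv2.add h'.u_deriv2
  v_deriv := h.v_deriv.add h'.v_deriv
  w_deriv := h.w_deriv.add h'.w_deriv
  w_deriv2 := h.w_deriv2.add h'.w_deriv2
  neumann := by
    have := h.neumann.add h'.neumann
    rw [add_zero] at this
    exact this
  flux := by
    obtain ⟨c, h1, h2⟩ := h.flux
    obtain ⟨d, h3, h4⟩ := h'.flux
    exact ⟨c + d, h1.add h3, h2.add h4⟩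
  coupling := by
    obtain ⟨c, h1, h2⟩ := h.coupling
    obtain ⟨d, h3, h4⟩ := h'.coupling
    exact ⟨c + d, h1.add h3, h2.add h4⟩

theorem DomainData.smul {x : X} {p q : L2 waveI} {r s : L2 heatI} (k : ℂ)
    (h : DomainData x p q r s) :
    DomainData (k • x) (k • p) (k • q) (k • r) (k • s) where
  u_deriv2 := h.u_deriv2.smul k
  v_deriv := h.v_deriv.smul k
  w_deriv := h.w_deriv.smul k
  w_deriv2 := h.w_deriv2.smul k
  neumann := by
    have := h.neumann.smul k
    rw [smul_zero] at this
    exact this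
  flux := by
    obtain ⟨c, h1, h2⟩ := h.flux
    exact ⟨k • c, h1.smul k, h2.smul k⟩
  coupling := by
    obtain ⟨c, h1, h2⟩ := h.coupling
    exact ⟨k • c, h1.smul k, h2.smul k⟩

/-- The domain `D(A)`. -/
def domA : Submodule ℂ X where
  carrier := {x | ∃ p q r s, DomainData x p q r s}
  add_mem' := fun ⟨_, _, _, _, h⟩ ⟨_, _, _, _, h'⟩ => ⟨_, _, _, _, h.add h'⟩
  zero_mem' := ⟨0, 0, 0, 0,
    IsWeakDeriv.zero, IsWeakDeriv.zero, IsWeakDeriv.zero, IsWeakDeriv.zero,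
    HasBoundaryValue.zero, ⟨0, HasBoundaryValue.zero, HasBoundaryValue.zero⟩,
    ⟨0, HasBoundaryValue.zero, HasBoundaryValue.zero⟩⟩
  smul_mem' := fun k _ ⟨_, _, _, _, h⟩ => ⟨_, _, _, _, h.smul k⟩

theorem exists_domainData (x : domA) : ∃ p q r s, DomainData x.1 p q r s := x.2

theorem velocity_isWeakDeriv (x : domA) : IsWeakDeriv (X.v x.1) (weakDeriv (X.v x.1)) := by
  obtain ⟨p, q, r, s, h⟩ := exists_domainData x
  exact h.v_deriv.weakDeriv_eq.symm ▸ h.v_deriv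

/-- The formula `A (u, v, w) = (v, u'', w'')` on `D(A)`; the first component is `v`, viewed as
an element of `H¹(-1,0)`. -/
noncomputable def funA (x : domA) : X :=
  X.mk (H1.mk (X.v x.1) (weakDeriv (X.v x.1)) (velocity_isWeakDeriv x))
    (weakDeriv (H1.der (X.u x.1))) (weakDeriv (weakDeriv (X.w x.1)))

theorem H1.mk_congr {Ω : TopologicalSpace.Opens ℝ} {f f' g g' : L2 Ω} (hf : f = f')
    (hg : g = g') (h : IsWeakDeriv f g) (h' : IsWeakDeriv f' g') :
    H1.mk f g h = H1.mk f' g' h' := by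
  subst hf hg; rfl

theorem funA_eq {x : domA} {p q : L2 waveI} {r s : L2 heatI} (h : DomainData x.1 p q r s) :
    funA x = X.mk (H1.mk (X.v x.1) q h.v_deriv) p s := by
  rw [funA, h.u_deriv2.weakDeriv_eq, h.w_deriv.weakDeriv_eq, h.w_deriv2.weakDeriv_eq,
    H1.mk_congr rfl h.v_deriv.weakDeriv_eq _ h.v_deriv]

theorem funA_add (x y : domA) : funA (x + y) = funA x + funA y := by
  obtain ⟨p, q, r, s, h⟩ := exists_domainData x
  obtain ⟨p', q', r', s', h'⟩ := exists_domainData y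
  have hxy : DomainData (x + y : domA).1 (p + p') (q + q') (r + r') (s + s') := h.add h'
  rw [funA_eq h, funA_eq h', funA_eq hxy, X.mk_add, H1.mk_add]
  congr 1

theorem funA_smul (k : ℂ) (x : domA) : funA (k • x) = k • funA x := by
  obtain ⟨p, q, r, s, h⟩ := exists_domainData x
  have hx : DomainData (k • x : domA).1 (k • p) (k • q) (k • r) (k • s) := h.smul k
  rw [funA_eq h, funA_eq hx, X.mk_smul, H1.mk_smul]
  congr 1

/-- The operator `A` on `X`, with domain `D(A)`. -/
noncomputable def A : X →ₗ.[ℂ] X where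
  domain := domA
  toFun :=
    { toFun := funA
      map_add' := funA_add
      map_smul' := funA_smul }

/-! ## The constant function `1` -/

theorem memLp_one : MemLp (fun _ : ℝ => (1 : ℂ)) 2 (volume.restrict (waveI : Set ℝ)) := by
  have : IsFiniteMeasure (volume.restrict (waveI : Set ℝ)) := ⟨by simp [waveI]⟩
  exact memLp_const 1

/-- The constant function `1` in `L²(-1,0)`. -/
noncomputable def oneL2 : L2 waveI := memLp_one.toLp (fun _ : ℝ => (1 : ℂ))

theorem isWeakDeriv_oneL2 : IsWeakDeriv oneL2 0 := by
  intro φ hφ hs hΩ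
  have e1 : (fun x => deriv φ x • oneL2 x) =ᵐ[volume.restrict (waveI : Set ℝ)]
      fun x => ((deriv φ x : ℝ) : ℂ) := by
    filter_upwards [memLp_one.coeFn_toLp] with x hx
    rw [oneL2, hx]; simp
  have e2 : (fun x => φ x • (0 : L2 waveI) x) =ᵐ[volume.restrict (waveI : Set ℝ)] 0 := by
    filter_upwards [Lp.coeFn_zero ℂ 2 (volume.restrict (waveI : Set ℝ))] with x hx
    rw [hx]; simp
  rw [integral_congr_ae e1, integral_congr_ae e2, integral_complex_ofReal,
    setIntegral_eq_integral_of_forall_compl_eq_zero]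
  · have hd : Continuous (deriv φ) := hφ.continuous_deriv (by simp)
    have := integral_eq_zero_of_hasDerivAt_of_integrable (f := φ) (f' := deriv φ)
      (fun x => (hφ.differentiable (by simp) x).hasDerivAt)
      (hd.integrable_of_hasCompactSupport hs.deriv)
      (hφ.continuous.integrable_of_hasCompactSupport hs)
    rw [this]; simp
  · intro x hx
    exact image_eq_zero_of_notMem_tsupport
      (fun hx' => hx (hΩ (tsupport_deriv_subset hx')))

/-- The constant function `1` in `H¹(-1,0)`. -/
noncomputable def oneH1 : H1 waveI := H1.mk oneL2 0 isWeakDeriv_oneL2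

end WaveHeat

/-!
The energy seminorm `‖u'‖² + ‖v‖² + ‖w‖²` does not increase along `A`: integrating by parts on
`(-1, 0)` and on `(0, ∞)`, the interface terms cancel by the coupling conditions, the term at `-1`
vanishes by the Neumann condition, and `-‖w'‖²` is left (`WaveHeat.DomainData.re_energy_eq`). The
norm of `X` adds `‖u‖²` to the energy, which costs `Re ⟨u, v⟩ ≤ ‖x‖² / 2`, so `A - 1/2` is
dissipative (`WaveHeat.re_inner_A_le`).

Generation follows from the Lumer–Phillips theorem, proved here in Hilbert space by Yosida
approximation (`LinearPMap.exists_c0Semigroup`), once `1 - A` is onto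
(`WaveHeat.exists_sub_A_eq`). For `λ = 1` the resolvent equation is solved by an orthogonal
projection: the pair `(v, w)`, viewed as one function `z` on `(-1, ∞)`, has to satisfy
`⟨φ, z - (g, h)⟩ + ⟨φ', z' + (f', 0)⟩ = 0` for all `φ ∈ H¹(-1, ∞)`, that is, `(z, z')` is the
projection of `((g, h), -(f', 0))` to `H¹(-1, ∞) ⊆ L² × L²`. Membership of `z` in `H¹(-1, ∞)`
encodes `v(0) = w(0)`, the flux `z' + (f', 0)` lies in `H¹(-1, ∞)` as well, which encodes
`u'(0) = w'(0)`, and `u'(-1) = 0` is the natural boundary condition.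

A kernel vector has `v = 0`, `u'' = 0`, `w'' = 0`. Constants in `L²(0, ∞)` vanish, so `w = 0`, and
`u' = 0` by the Neumann condition, which leaves `u` constant. For the density of the range, a
vector `(f, g, h)` orthogonal to it has `h'' = 0` weakly on `(0, ∞)`, so `h` is affine and square
integrable, hence zero (`WaveHeat.eq_zero_of_integral_deriv2_smul_eq_zero`). Since `v ∈ H¹` and
`u'' ∈ L²` are arbitrary in `D(A)`, also `f = 0` and `g = 0`.

If the semigroup were bounded, then for `x₀ ∈ Ker A` and `y ∈ D(A)` the identity
`T(t) y - y - t x₀ = ∫₀ᵗ T(s) (A y - x₀) ds` would give `t ‖x₀‖ ≤ C + M t ‖A y - x₀‖`. The range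
being dense, `x₀ = 0` (`C0Semigroup.eq_zero_of_hasGenValue_zero`), which contradicts
`(1, 0, 0) ∈ Ker A`.
-/

/-! ### Dissipative operators, their resolvents and Yosida approximations -/

namespace Dissipative

variable {E : Type*} [NormedAddCommGroup E] [InnerProductSpace ℂ E]
  {D : Submodule ℂ E} {L : D →ₗ[ℂ] E}

theorem mul_norm_le_norm_smul_sub (hd : ∀ x : D, (inner ℂ (x : E) (L x)).re ≤ 0) (l : ℝ) (x : D) :
    l * ‖(x : E)‖ ≤ ‖(l : ℂ) • (x : E) - L x‖ := by
  have h1 : l * ‖(x : E)‖ ^ 2 ≤ (inner ℂ (x : E) ((l : ℂ) • (x : E) - L x)).re := by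
    rw [inner_sub_right, inner_smul_right, Complex.sub_re, Complex.re_ofReal_mul]
    have : (inner ℂ (x : E) (x : E)).re = ‖(x : E)‖ ^ 2 := inner_self_eq_norm_sq (𝕜 := ℂ) (x : E)
    rw [this]; linarith [hd x]
  have h2 : (inner ℂ (x : E) ((l : ℂ) • (x : E) - L x)).re ≤ ‖(x : E)‖ * ‖(l : ℂ) • (x : E) - L x‖ :=
    re_inner_le_norm (𝕜 := ℂ) _ _
  rcases (norm_nonneg (x : E)).eq_or_lt with h0 | h0
  · rw [← h0, mul_zero]; exact norm_nonneg _
  · nlinarith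

/-- The resolvent `R = (l - L)⁻¹` of a dissipative operator, with `‖R‖ ≤ 1 / l`. -/
theorem exists_resolvent (hd : ∀ x : D, (inner ℂ (x : E) (L x)).re ≤ 0) {l : ℝ} (hl : 0 < l)
    (hs : ∀ y, ∃ x : D, (l : ℂ) • (x : E) - L x = y) :
    ∃ R : E →L[ℂ] E, (∀ y, ∃ h : R y ∈ D, (l : ℂ) • R y - L ⟨R y, h⟩ = y) ∧
      (∀ x : D, R ((l : ℂ) • (x : E) - L x) = x) ∧ ∀ y, l * ‖R y‖ ≤ ‖y‖ := by
  let S : D →ₗ[ℂ] E := (l : ℂ) • D.subtype - L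
  have hS : ∀ x : D, S x = (l : ℂ) • (x : E) - L x := fun x => rfl
  have hb : ∀ x : D, l * ‖(x : E)‖ ≤ ‖S x‖ := fun x => mul_norm_le_norm_smul_sub hd l x
  have hinj : Function.Injective S := by
    rw [← LinearMap.ker_eq_bot, LinearMap.ker_eq_bot']
    intro x hx
    have := hb x
    rw [hx, norm_zero] at this
    have h0 : ‖(x : E)‖ = 0 := le_antisymm (by nlinarith) (norm_nonneg _)
    exact Subtype.ext (norm_eq_zero.1 h0)
  let e : D ≃ₗ[ℂ] E := LinearEquiv.ofBijective S ⟨hinj, hs⟩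
  have he : ∀ y, S (e.symm y) = y := fun y => e.apply_symm_apply y
  have hbd : ∀ y, l * ‖(e.symm y : E)‖ ≤ ‖y‖ := fun y => by
    have := hb (e.symm y)
    rwa [he] at this
  refine ⟨(D.subtype ∘ₗ e.symm.toLinearMap).mkContinuous l⁻¹ fun y => ?_, fun y => ⟨?_, ?_⟩,
    fun x => ?_, fun y => ?_⟩
  · rw [inv_mul_eq_div, le_div_iff₀ hl, mul_comm]
    exact hbd y
  · exact (e.symm y).2
  · exact he y
  · exact congrArg Subtype.val (e.symm_apply_apply x)
  · exact hbd y

/-- If `l - L` is onto, a Neumann series makes `m - L` onto for all `m` with `|m - l| < l`. -/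
theorem surjective_of_abs_sub_lt [CompleteSpace E]
    (hd : ∀ x : D, (inner ℂ (x : E) (L x)).re ≤ 0) {l m : ℝ} (hl : 0 < l) (hm : |m - l| < l)
    (hs : ∀ y, ∃ x : D, (l : ℂ) • (x : E) - L x = y) (y : E) :
    ∃ x : D, (m : ℂ) • (x : E) - L x = y := by
  obtain ⟨R, hR, -, hb⟩ := exists_resolvent hd hl hs
  have hn : ‖((l : ℂ) - m) • R‖ < 1 := by
    have hR' : ‖R‖ ≤ l⁻¹ := R.opNorm_le_bound (by positivity) fun y => by
      rw [inv_mul_eq_div, le_div_iff₀ hl, mul_comm]; exact hb y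
    have h1 : ‖(l : ℂ) - m‖ = |m - l| := by
      rw [← Complex.ofReal_sub, Complex.norm_real, Real.norm_eq_abs, abs_sub_comm]
    calc ‖((l : ℂ) - m) • R‖ = |m - l| * ‖R‖ := by rw [norm_smul, h1]
      _ ≤ |m - l| * l⁻¹ := by gcongr
      _ < l * l⁻¹ := by gcongr
      _ = 1 := mul_inv_cancel₀ hl.ne'
  obtain ⟨U, hU⟩ := isUnit_one_sub_of_norm_lt_one hn
  set z : E := (↑U⁻¹ : E →L[ℂ] E) y with hz
  have hUz : z - ((l : ℂ) - m) • R z = y := by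
    have h1 : ((U : E →L[ℂ] E) * (↑U⁻¹ : E →L[ℂ] E)) y = y := by rw [U.mul_inv]; rfl
    rw [hU] at h1
    exact h1
  obtain ⟨h, e⟩ := hR z
  refine ⟨⟨R z, h⟩, ?_⟩
  show (m : ℂ) • R z - L ⟨R z, h⟩ = y
  rw [← hUz, eq_sub_of_add_eq' (sub_eq_iff_eq_add.1 e).symm]
  module

/-- Each Neumann series step enlarges the parameter interval by the factor `3 / 2`. -/
theorem surjective_of_pos [CompleteSpace E] (hd : ∀ x : D, (inner ℂ (x : E) (L x)).re ≤ 0) {l : ℝ}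
    (hl : 0 < l) (hs : ∀ y, ∃ x : D, (l : ℂ) • (x : E) - L x = y) {m : ℝ} (hm : 0 < m) (y : E) :
    ∃ x : D, (m : ℂ) • (x : E) - L x = y := by
  have key : ∀ n : ℕ, ∀ m : ℝ, 0 < m → m < (3 / 2) ^ n * l →
      ∀ y, ∃ x : D, (m : ℂ) • (x : E) - L x = y := by
    intro n
    induction n with
    | zero =>
      intro m hm hml y
      refine surjective_of_abs_sub_lt hd hl ?_ hs y
      rw [abs_lt]; constructor <;> linarith
    | succ n ih =>
      intro m hm hml y
      refine surjective_of_abs_sub_lt (l := 2 / 3 * m) hd (by linarith) ?_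
        (ih _ (by linarith) ?_) y
      · rw [abs_lt]; constructor <;> linarith
      · rw [pow_succ] at hml; linarith
  obtain ⟨n, hn⟩ := pow_unbounded_of_one_lt (m / l) (by norm_num : (1 : ℝ) < 3 / 2)
  exact key n m hm ((div_lt_iff₀ hl).1 hn) y

/-- A vector orthogonal to `D` is `l x - L x` for some `x ∈ D`; pairing with `x` gives `x = 0`. -/
theorem dense_domain [CompleteSpace E] (hd : ∀ x : D, (inner ℂ (x : E) (L x)).re ≤ 0) {l : ℝ}
    (hl : 0 < l) (hs : ∀ y, ∃ x : D, (l : ℂ) • (x : E) - L x = y) : Dense (D : Set E) := by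
  rw [Submodule.dense_iff_topologicalClosure_eq_top, Submodule.topologicalClosure_eq_top_iff,
    Submodule.eq_bot_iff]
  intro y hy
  obtain ⟨x, rfl⟩ := hs y
  have h0 := (Submodule.mem_orthogonal _ _).1 hy x x.2
  have h1 : l * ‖(x : E)‖ ^ 2 ≤ 0 := by
    have h2 := congrArg Complex.re h0
    rw [inner_sub_right, inner_smul_right, Complex.sub_re, Complex.re_ofReal_mul] at h2
    have : (inner ℂ (x : E) (x : E)).re = ‖(x : E)‖ ^ 2 := inner_self_eq_norm_sq (𝕜 := ℂ) (x : E)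
    rw [this, Complex.zero_re] at h2; linarith [hd x]
  have hx : x = 0 := by
    have : ‖(x : E)‖ ^ 2 = 0 := le_antisymm (by nlinarith) (sq_nonneg _)
    exact Subtype.ext (norm_eq_zero.1 (pow_eq_zero_iff two_ne_zero |>.1 this))
  simp [hx]

/-- The exponential of a bounded dissipative operator is a contraction. -/
theorem norm_exp_smul_apply_le [CompleteSpace E] {B : E →L[ℂ] E}
    (hB : ∀ x, (inner ℂ x (B x)).re ≤ 0) {t : ℝ} (ht : 0 ≤ t) (x : E) :
    ‖NormedSpace.exp (t • B) x‖ ≤ ‖x‖ := by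
  have hder : ∀ s : ℝ, HasDerivAt (fun s : ℝ => NormedSpace.exp (s • B) x)
      (B (NormedSpace.exp (s • B) x)) s := fun s =>
    ((ContinuousLinearMap.apply ℂ E x).restrictScalars ℝ).hasFDerivAt.comp_hasDerivAt s
      (hasDerivAt_exp_smul_const' B s)
  let _ : InnerProductSpace ℝ E := InnerProductSpace.complexToReal
  have hanti : Antitone fun s : ℝ => ‖NormedSpace.exp (s • B) x‖ ^ 2 := by
    refine antitone_of_hasDerivAt_nonpos (fun s => (hder s).norm_sq) fun s => ?_
    rw [real_inner_eq_re_inner ℂ]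
    have := hB (NormedSpace.exp (s • B) x)
    simp only [RCLike.re_to_complex, Pi.zero_apply]
    linarith
  have := hanti ht
  simp only [zero_smul, NormedSpace.exp_zero, one_apply_eq_self] at this
  exact le_of_sq_le_sq this (norm_nonneg _)

theorem hasDerivAt_exp_smul_apply [CompleteSpace E] (B : E →L[ℂ] E) (x : E) (s : ℝ) :
    HasDerivAt (fun s : ℝ => NormedSpace.exp (s • B) x) (NormedSpace.exp (s • B) (B x)) s :=
  ((ContinuousLinearMap.apply ℂ E x).restrictScalars ℝ).hasFDerivAt.comp_hasDerivAt s
    (hasDerivAt_exp_smul_const B s)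

theorem norm_exp_smul_sub_le [CompleteSpace E] {B C : E →L[ℂ] E} (hBC : Commute B C)
    (hB : ∀ x, (inner ℂ x (B x)).re ≤ 0) (hC : ∀ x, (inner ℂ x (C x)).re ≤ 0) {t : ℝ}
    (ht : 0 ≤ t) (x : E) :
    ‖NormedSpace.exp (t • B) x - NormedSpace.exp (t • C) x‖ ≤ ‖B x - C x‖ * t := by
  -- the path `s ↦ exp (s B) exp ((t - s) C) x` joins the two vectors
  let _ : NormedAlgebra ℚ (E →L[ℂ] E) := NormedAlgebra.restrictScalars ℚ ℂ _
  have hder : ∀ s : ℝ, HasDerivAt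
      (fun s : ℝ => (NormedSpace.exp (s • B + (t - s) • C)) x)
      (NormedSpace.exp (s • B) (NormedSpace.exp ((t - s) • C) (B x - C x))) s := by
    intro s
    have h1 : HasDerivAt (fun s : ℝ => NormedSpace.exp (t • C) (NormedSpace.exp (s • (B - C)) x))
        (NormedSpace.exp (t • C) (NormedSpace.exp (s • (B - C)) ((B - C) x))) s :=
      ((NormedSpace.exp (t • C)).restrictScalars ℝ).hasFDerivAt.comp_hasDerivAt s
        (hasDerivAt_exp_smul_apply (B - C) x s)
    have hc : ∀ s : ℝ, Commute (t • C) (s • (B - C)) := fun s =>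
      ((hBC.symm.sub_right (Commute.refl C)).smul_left t).smul_right s
    have e1 : ∀ s : ℝ, NormedSpace.exp (s • B + (t - s) • C) =
        NormedSpace.exp (t • C) * NormedSpace.exp (s • (B - C)) := fun s => by
      rw [← NormedSpace.exp_add_of_commute (hc s)]
      congr 1
      module
    have e2 : NormedSpace.exp (s • B) * NormedSpace.exp ((t - s) • C) =
        NormedSpace.exp (t • C) * NormedSpace.exp (s • (B - C)) := by
      rw [← e1, NormedSpace.exp_add_of_commute ((hBC.smul_left s).smul_right (t - s))]
    simp only [e1]
    have e3 := DFunLike.congr_fun e2 ((B - C) x)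
    simp only [mul_apply_eq_comp, sub_apply] at e3 h1 ⊢
    rw [e3]
    exact h1
  have := norm_image_sub_le_of_norm_deriv_le_segment' (a := 0) (b := t) (C := ‖B x - C x‖)
    (fun s _ => (hder s).hasDerivWithinAt) (fun s hs =>
      (norm_exp_smul_apply_le hB hs.1 _).trans (norm_exp_smul_apply_le hC (by linarith [hs.2]) _))
    t ⟨ht, le_rfl⟩
  simpa using this

theorem norm_exp_smul_sub_self_le [CompleteSpace E] {B : E →L[ℂ] E}
    (hB : ∀ x, (inner ℂ x (B x)).re ≤ 0) {t : ℝ} (ht : 0 ≤ t) (x : E) :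
    ‖NormedSpace.exp (t • B) x - x‖ ≤ ‖B x‖ * t := by
  have := norm_exp_smul_sub_le (Commute.zero_right B) hB (by simp) ht x
  simpa using this

/-- First order expansion of `exp (t B) x`. The remainder is controlled by an auxiliary vector `z`
rather than by `B (B x)`, so that it stays bounded along the Yosida approximations: `z` is later a
point of the domain close to `L x`. -/
theorem norm_exp_smul_sub_self_sub_le [CompleteSpace E] {B : E →L[ℂ] E}
    (hB : ∀ x, (inner ℂ x (B x)).re ≤ 0) {t : ℝ} (ht : 0 ≤ t) (x z : E) :
    ‖NormedSpace.exp (t • B) x - x - t • B x‖ ≤ (2 * ‖B x - z‖ + t * ‖B z‖) * t := by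
  have hder : ∀ s : ℝ, HasDerivAt
      (fun s : ℝ => NormedSpace.exp (s • B) x - s • B x)
      (NormedSpace.exp (s • B) (B x) - B x) s := fun s => by
    simpa using! (hasDerivAt_exp_smul_apply B x s).sub ((hasDerivAt_id s).smul_const (B x))
  have := norm_image_sub_le_of_norm_deriv_le_segment' (a := 0) (b := t)
    (C := 2 * ‖B x - z‖ + t * ‖B z‖)
    (fun s _ => (hder s).hasDerivWithinAt) (fun s hs => ?_) t ⟨ht, le_rfl⟩
  · simpa [sub_right_comm] using this
  · have e : NormedSpace.exp (s • B) (B x) - B x = NormedSpace.exp (s • B) (B x - z) +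
        (NormedSpace.exp (s • B) z - z) - (B x - z) := by rw [map_sub]; abel
    have h1 := norm_exp_smul_apply_le hB hs.1 (B x - z)
    have h2 := norm_exp_smul_sub_self_le hB hs.1 z
    have h3 : ‖B z‖ * s ≤ t * ‖B z‖ := by
      rw [mul_comm]; exact mul_le_mul_of_nonneg_right hs.2.le (norm_nonneg _)
    rw [e]
    refine (norm_sub_le _ _).trans ?_
    have h4 := norm_add_le (NormedSpace.exp (s • B) (B x - z)) (NormedSpace.exp (s • B) z - z)
    linarith

/-- The Yosida approximation: bounded, commuting, dissipative operators `B n` converging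
pointwise on `D` to `L`, and dominated there by `L`. -/
theorem exists_yosida [CompleteSpace E] (hd : ∀ x : D, (inner ℂ (x : E) (L x)).re ≤ 0) {l : ℝ}
    (hl : 0 < l) (hs : ∀ y, ∃ x : D, (l : ℂ) • (x : E) - L x = y) :
    ∃ B : ℕ → E →L[ℂ] E, (∀ m n, Commute (B m) (B n)) ∧
      (∀ n x, (inner ℂ x (B n x)).re ≤ 0) ∧ (∀ n (x : D), ‖B n x‖ ≤ ‖L x‖) ∧
      ∀ x : D, Tendsto (fun n => B n x) atTop (𝓝 (L x)) := by
  have hpos : ∀ n : ℕ, (0 : ℝ) < n + 1 := fun n => by positivity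
  choose R hR1 hR2 hR3 using fun n : ℕ =>
    exists_resolvent hd (hpos n) (surjective_of_pos hd hl hs (hpos n))
  choose hRD hR1 using hR1
  -- the contractions `J n = (n + 1) (n + 1 - L)⁻¹`
  set J : ℕ → E →L[ℂ] E := fun n => (((n : ℝ) + 1 : ℝ) : ℂ) • R n with hJ
  have hJn : ∀ n x, ‖J n x‖ ≤ ‖x‖ := fun n x => by
    have := hR3 n x
    rwa [hJ, smul_apply, norm_smul, Complex.norm_real, Real.norm_eq_abs,
      abs_of_pos (hpos n)]
  have hres : ∀ m n y, R n y = R m y + ((((m : ℝ) + 1 : ℝ) : ℂ) - (((n : ℝ) + 1 : ℝ) : ℂ)) •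
      R m (R n y) := by
    intro m n y
    have h1 := hR2 m ⟨R n y, hRD n y⟩
    have h2 : (((m : ℝ) + 1 : ℝ) : ℂ) • R n y - L ⟨R n y, hRD n y⟩ =
        y + ((((m : ℝ) + 1 : ℝ) : ℂ) - (((n : ℝ) + 1 : ℝ) : ℂ)) • R n y := by
      rw [eq_sub_of_add_eq' (sub_eq_iff_eq_add.1 (hR1 n y)).symm]
      module
    rw [h2, map_add, map_smul] at h1
    exact h1.symm
  have hcomm : ∀ m n, Commute (R m) (R n) := by
    intro m n
    by_cases hmn : m = n
    · rw [hmn]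
    · ext y
      rw [mul_apply_eq_comp, mul_apply_eq_comp]
      have hne : ((((m : ℝ) + 1 : ℝ) : ℂ) - (((n : ℝ) + 1 : ℝ) : ℂ)) ≠ 0 := by
        rw [sub_ne_zero]
        intro h
        exact hmn (by exact_mod_cast add_right_cancel (Complex.ofReal_injective h))
      refine smul_right_injective E hne ?_
      have h1 := hres m n y
      have h2 := hres n m y
      show _ • _ = _ • _
      have h3 : ((((m : ℝ) + 1 : ℝ) : ℂ) - (((n : ℝ) + 1 : ℝ) : ℂ)) • R m (R n y) =
        R n y - R m y := by rw [eq_sub_iff_add_eq, add_comm, ← h1]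
      have h4 : ((((n : ℝ) + 1 : ℝ) : ℂ) - (((m : ℝ) + 1 : ℝ) : ℂ)) • R n (R m y) =
        R m y - R n y := by rw [eq_sub_iff_add_eq, add_comm, ← h2]
      rw [h3, ← neg_sub (R m y), ← h4, ← neg_smul, neg_sub]
  have hJD : ∀ (n : ℕ) (x : D), (((n : ℝ) + 1 : ℝ) : ℂ) • (J n x - (x : E)) = J n (L x) := by
    intro n x
    have h1 := hR2 n x
    rw [map_sub, map_smul, sub_eq_iff_eq_add] at h1
    have h2 : J n x - (x : E) = R n (L x) := by
      rw [sub_eq_iff_eq_add']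
      exact h1
    rw [h2]; rfl
  have hlim1 : ∀ x : D, Tendsto (fun n => J n x) atTop (𝓝 (x : E)) := by
    intro x
    rw [tendsto_iff_norm_sub_tendsto_zero]
    have h0 : Tendsto (fun n : ℕ => ‖L x‖ * (1 / ((n : ℝ) + 1))) atTop (𝓝 0) := by
      simpa using tendsto_one_div_add_atTop_nhds_zero_nat.const_mul ‖L x‖
    refine squeeze_zero (fun _ => norm_nonneg _) (fun n => ?_) h0
    have h1 := hJn n (L x)
    rw [← hJD, norm_smul, Complex.norm_real, Real.norm_eq_abs, abs_of_pos (hpos n)] at h1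
    rw [mul_one_div, le_div_iff₀ (hpos n), mul_comm]
    exact h1
  have hlim : ∀ y, Tendsto (fun n => J n y) atTop (𝓝 y) := by
    intro y
    rw [Metric.tendsto_atTop]
    intro ε hε
    obtain ⟨z, hz, hyz⟩ := Metric.dense_iff.1 (dense_domain hd hl hs) y (ε / 3) (by positivity)
    rw [Metric.mem_ball, dist_comm, dist_eq_norm] at hz
    obtain ⟨N, hN⟩ := Metric.tendsto_atTop.1 (hlim1 ⟨z, hyz⟩) (ε / 3) (by positivity)
    refine ⟨N, fun n hn => ?_⟩
    have h1 := hN n hn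
    have h2 := hJn n (y - z)
    rw [dist_eq_norm] at h1 ⊢
    have e : J n y - y = J n (y - z) + (J n z - z) - (y - z) := by rw [map_sub]; abel
    rw [e]
    have h3 := norm_sub_le (J n (y - z) + (J n z - z)) (y - z)
    have h4 := norm_add_le (J n (y - z)) (J n z - z)
    simp only at h1
    linarith
  refine ⟨fun n => (((n : ℝ) + 1 : ℝ) : ℂ) • (J n - 1), fun m n => ?_, fun n x => ?_,
    fun n x => ?_, fun x => ?_⟩
  · refine Commute.smul_left (Commute.smul_right ?_ _) _
    exact ((((hcomm m n).smul_left _).smul_right _).sub_left (Commute.one_left _)).sub_right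
      (Commute.one_right _)
  · rw [smul_apply, inner_smul_right, Complex.re_ofReal_mul]
    refine mul_nonpos_of_nonneg_of_nonpos (hpos n).le ?_
    rw [sub_apply, one_apply_eq_self, inner_sub_right,
      Complex.sub_re]
    have h1 : (inner ℂ x x).re = ‖x‖ ^ 2 := inner_self_eq_norm_sq (𝕜 := ℂ) x
    have h2 : (inner ℂ x (J n x)).re ≤ ‖x‖ * ‖J n x‖ := re_inner_le_norm (𝕜 := ℂ) _ _
    have h3 := mul_le_mul_of_nonneg_left (hJn n x) (norm_nonneg x)
    nlinarith
  · have h1 := hJD n x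
    simp only [smul_apply, sub_apply,
      one_apply_eq_self]
    rw [h1]
    exact hJn n _
  · refine (hlim (L x)).congr fun n => ?_
    rw [← hJD]; rfl

end Dissipative

/-! ### Bounded semigroups and their generators -/

namespace C0Semigroup

variable {E : Type*} [NormedAddCommGroup E] [NormedSpace ℂ E] {T : C0Semigroup E}

theorem hasGenValue_generator (T : C0Semigroup E) (x : T.generator.domain) :
    T.HasGenValue x (T.generator x) :=
  x.2.choose_spec

/-- Orbits of a bounded semigroup are continuous on `[0, ∞)`, here extended by a constant to the
negative half-line. -/
theorem continuous_orbit (hT : T.IsBounded) (x : E) :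
    Continuous fun t : ℝ => T.op t.toNNReal x := by
  obtain ⟨M, hM⟩ := hT
  have hM0 : 0 ≤ M := (norm_nonneg _).trans (hM 0)
  suffices h : Continuous fun t : ℝ≥0 => T.op t x from h.comp continuous_real_toNNReal
  have hle : ∀ s t : ℝ≥0, s ≤ t → ‖T.op t x - T.op s x‖ ≤ M * ‖T.op (t - s) x - x‖ := by
    intro s t hst
    have e : T.op t x - T.op s x = T.op s (T.op (t - s) x - x) := by
      rw [map_sub, ← ContinuousLinearMap.comp_apply, ← T.op_add, add_tsub_cancel_of_le hst]
    rw [e]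
    exact ((T.op s).le_opNorm _).trans (mul_le_mul_of_nonneg_right (hM s) (norm_nonneg _))
  have h0 : Tendsto (fun t : ℝ≥0 => M * ‖T.op t x - x‖) (𝓝 0) (𝓝 0) := by
    have h1 : Tendsto (fun t : ℝ≥0 => T.op t x) (𝓝 0) (𝓝 x) := by
      have h2 : ContinuousWithinAt (fun t : ℝ≥0 => T.op t x) (Ioi 0) 0 := by
        have := T.strongly_continuous x
        simpa [ContinuousWithinAt, T.op_zero] using this
      have h3 := continuousWithinAt_Ioi_iff_Ici.1 h2
      have : Ici (0 : ℝ≥0) = univ := by ext; simp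
      rw [this, continuousWithinAt_univ] at h3
      simpa [ContinuousAt, T.op_zero] using h3
    have := ((h1.sub_const x).norm).const_mul M
    simpa using this
  rw [continuous_iff_continuousAt]
  intro t
  rw [ContinuousAt, tendsto_iff_norm_sub_tendsto_zero]
  have h1 : Tendsto (fun s : ℝ≥0 => M * ‖T.op (s - t) x - x‖ + M * ‖T.op (t - s) x - x‖) (𝓝 t)
      (𝓝 0) := by
    have ha : Tendsto (fun s : ℝ≥0 => s - t) (𝓝 t) (𝓝 0) :=
      (continuous_id.sub continuous_const).tendsto' t 0 (by simp)
    have hb : Tendsto (fun s : ℝ≥0 => t - s) (𝓝 t) (𝓝 0) :=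
      (continuous_const.sub continuous_id).tendsto' t 0 (by simp)
    simpa using (h0.comp ha).add (h0.comp hb)
  refine squeeze_zero (fun _ => norm_nonneg _) (fun s => ?_) h1
  have p1 : 0 ≤ M * ‖T.op (s - t) x - x‖ := mul_nonneg hM0 (norm_nonneg _)
  have p2 : 0 ≤ M * ‖T.op (t - s) x - x‖ := mul_nonneg hM0 (norm_nonneg _)
  rcases le_total s t with h | h
  · have := hle s t h
    rw [norm_sub_rev]; linarith
  · have := hle t s h
    linarith

theorem HasGenValue.hasDerivWithinAt_orbit {x y : E} (h : T.HasGenValue x y) {t : ℝ} (ht : 0 ≤ t) :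
    HasDerivWithinAt (fun t : ℝ => T.op t.toNNReal x) (T.op t.toNNReal y) (Ici t) t := by
  rw [← hasDerivWithinAt_Ioi_iff_Ici, hasDerivWithinAt_iff_tendsto_slope' (by simp)]
  have h1 := ((T.op t.toNNReal).continuous.tendsto y).comp h
  have h2 : Tendsto (fun s : ℝ => (s - t).toNNReal) (𝓝[>] t) (𝓝[>] 0) := by
    refine tendsto_nhdsWithin_iff.2 ⟨?_, ?_⟩
    · refine Tendsto.mono_left ?_ nhdsWithin_le_nhds
      exact (continuous_real_toNNReal.comp (continuous_id.sub continuous_const)).tendsto' t 0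
        (by simp)
    · filter_upwards [self_mem_nhdsWithin] with s hs
      exact Real.toNNReal_pos.2 (sub_pos.2 hs)
  refine (h1.comp h2).congr' ?_
  filter_upwards [self_mem_nhdsWithin] with s hs
  have hs' : 0 ≤ s - t := (sub_pos.2 hs).le
  have e : s.toNNReal = t.toNNReal + (s - t).toNNReal := by
    rw [← Real.toNNReal_add ht hs', add_sub_cancel]
  rw [slope_def_module, e, T.op_add]
  simp only [Function.comp_apply, map_smul, map_sub, ContinuousLinearMap.comp_apply,
    Real.coe_toNNReal _ hs', ← Complex.ofReal_inv]
  rfl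

/-- For a bounded semigroup whose generator has dense range, the mean ergodic theorem excludes
nonzero vectors in the kernel of the generator. -/
theorem eq_zero_of_hasGenValue_zero (hT : T.IsBounded)
    (hd : Dense {y | ∃ x, T.HasGenValue x y}) {x₀ : E} (h₀ : T.HasGenValue x₀ 0) : x₀ = 0 := by
  obtain ⟨M, hM⟩ := id hT
  have hM0 : 0 ≤ M := (norm_nonneg _).trans (hM 0)
  have hfix : ∀ t : ℝ, 0 ≤ t → T.op t.toNNReal x₀ = x₀ := by
    intro t ht
    have := norm_image_sub_le_of_norm_deriv_right_le_segment (a := 0) (b := t) (C := 0)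
      (continuous_orbit hT x₀).continuousOn
      (fun s hs => h₀.hasDerivWithinAt_orbit hs.1) (fun s hs => by simp) t ⟨ht, le_rfl⟩
    simpa [T.op_zero, sub_eq_zero] using this
  -- `T(t) y - y - t x₀` is the integral of `T(s) (A y - x₀)`, hence `O(t ‖A y - x₀‖)`
  have key : ∀ y z, T.HasGenValue y z → ‖x₀‖ ≤ M * ‖z - x₀‖ := by
    intro y z hyz
    have h1 : ∀ t : ℝ, 0 ≤ t → t * ‖x₀‖ ≤ (M + 1) * ‖y‖ + M * ‖z - x₀‖ * t := by
      intro t ht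
      have := norm_image_sub_le_of_norm_deriv_right_le_segment (a := 0) (b := t)
        (C := M * ‖z - x₀‖) (f := fun s : ℝ => T.op s.toNNReal y - s • x₀)
        (f' := fun s : ℝ => T.op s.toNNReal z - x₀)
        ((continuous_orbit hT y).sub (by fun_prop)).continuousOn
        (fun s hs => by
          simpa using! (hyz.hasDerivWithinAt_orbit hs.1).sub
            (((hasDerivAt_id s).smul_const x₀).hasDerivWithinAt))
        (fun s hs => by
          have e : T.op s.toNNReal z - x₀ = T.op s.toNNReal (z - x₀) := by
            rw [map_sub, hfix s hs.1]
          rw [e]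
          exact ((T.op _).le_opNorm _).trans
            (mul_le_mul_of_nonneg_right (hM _) (norm_nonneg _))) t ⟨ht, le_rfl⟩
      simp only [Real.toNNReal_zero, T.op_zero, zero_smul, sub_zero,
        ContinuousLinearMap.id_apply] at this
      have e : t • x₀ = T.op t.toNNReal y - y - (T.op t.toNNReal y - t • x₀ - y) := by abel
      have h2 : ‖t • x₀‖ = t * ‖x₀‖ := by rw [norm_smul, Real.norm_eq_abs, abs_of_nonneg ht]
      have h3 := norm_sub_le (T.op t.toNNReal y - y) (T.op t.toNNReal y - t • x₀ - y)
      rw [← e, h2] at h3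
      have h4 := norm_sub_le (T.op t.toNNReal y) y
      have h5 := ((T.op t.toNNReal).le_opNorm y).trans
        (mul_le_mul_of_nonneg_right (hM _) (norm_nonneg y))
      linarith
    by_contra! hlt
    have h2 : 0 < ‖x₀‖ - M * ‖z - x₀‖ := sub_pos.2 hlt
    have h3 := h1 (((M + 1) * ‖y‖ + 1) / (‖x₀‖ - M * ‖z - x₀‖)) (by positivity)
    have h4 : ((M + 1) * ‖y‖ + 1) / (‖x₀‖ - M * ‖z - x₀‖) * (‖x₀‖ - M * ‖z - x₀‖) =
        (M + 1) * ‖y‖ + 1 := div_mul_cancel₀ _ h2.ne'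
    nlinarith
  by_contra hne
  have hpos : 0 < ‖x₀‖ := norm_pos_iff.2 hne
  obtain ⟨z, hz, y, hyz⟩ := Metric.dense_iff.1 hd x₀ (‖x₀‖ / (M + 1)) (by positivity)
  rw [Metric.mem_ball, dist_eq_norm, lt_div_iff₀ (by positivity)] at hz
  have := key y z hyz
  nlinarith [norm_nonneg (z - x₀)]

end C0Semigroup

/-! ### The Lumer–Phillips theorem -/

namespace Dissipative

variable {E : Type*} [NormedAddCommGroup E] [InnerProductSpace ℂ E]
  {D : Submodule ℂ E} {L : D →ₗ[ℂ] E}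

/-- Contractive form of the Lumer–Phillips theorem: the exponentials of the Yosida approximations
converge to a contraction semigroup. By the last estimate, used with `z` close to `L x`, its
derivative at `0` extends `L`. -/
theorem exists_contraction_semigroup [CompleteSpace E]
    (hd : ∀ x : D, (inner ℂ (x : E) (L x)).re ≤ 0) {l : ℝ}
    (hl : 0 < l) (hs : ∀ y, ∃ x : D, (l : ℂ) • (x : E) - L x = y) :
    ∃ S : ℝ≥0 → E →L[ℂ] E, S 0 = ContinuousLinearMap.id ℂ E ∧
      (∀ s t, S (s + t) = (S s).comp (S t)) ∧ (∀ t x, ‖S t x‖ ≤ ‖x‖) ∧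
      ∀ (x : D) (z : D) (t : ℝ≥0),
        ‖S t x - x - ((t : ℝ) : ℂ) • L x‖ ≤ (2 * ‖L x - z‖ + t * ‖L z‖) * t := by
  obtain ⟨B, hBc, hBd, hBb, hBlim⟩ := exists_yosida hd hl hs
  have hdense := dense_domain hd hl hs
  set T : ℕ → ℝ≥0 → E →L[ℂ] E := fun n t => NormedSpace.exp ((t : ℝ) • B n) with hT
  have hTn : ∀ n t x, ‖T n t x‖ ≤ ‖x‖ := fun n t x => norm_exp_smul_apply_le (hBd n) t.2 x
  have hcauchy : ∀ t x, CauchySeq fun n => T n t x := by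
    intro t x
    rw [Metric.cauchySeq_iff]
    intro ε hε
    obtain ⟨z, hz, hzD⟩ := Metric.dense_iff.1 hdense x (ε / 4) (by positivity)
    rw [Metric.mem_ball, dist_comm, dist_eq_norm] at hz
    have hc := (hBlim ⟨z, hzD⟩).cauchySeq
    obtain ⟨N, hN⟩ := Metric.cauchySeq_iff.1 hc (ε / (4 * (t + 1))) (by positivity)
    refine ⟨N, fun m hm n hn => ?_⟩
    have h1 := hN m hm n hn
    have h2 := norm_exp_smul_sub_le (hBc m n) (hBd m) (hBd n) t.2 z
    have h3 := hTn m t (x - z)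
    have h4 := hTn n t (x - z)
    rw [dist_eq_norm] at h1 ⊢
    have h5 : ‖B m z - B n z‖ * (t : ℝ) ≤ ε / 4 := by
      calc ‖B m z - B n z‖ * (t : ℝ) ≤ ε / (4 * (t + 1)) * (t + 1) := by gcongr; linarith
        _ = ε / 4 := by field_simp
    have e : T m t x - T n t x = T m t (x - z) + (T m t z - T n t z) - T n t (x - z) := by
      rw [map_sub, map_sub]; abel
    rw [e]
    have h6 := norm_sub_le (T m t (x - z) + (T m t z - T n t z)) (T n t (x - z))
    have h7 := norm_add_le (T m t (x - z)) (T m t z - T n t z)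
    have h8 : ‖T m t z - T n t z‖ ≤ ε / 4 := h2.trans h5
    linarith
  choose S0 hS0 using fun t x => cauchySeq_tendsto_of_complete (hcauchy t x)
  have hSn : ∀ t x, ‖S0 t x‖ ≤ ‖x‖ := fun t x =>
    le_of_tendsto (hS0 t x).norm (Eventually.of_forall fun n => hTn n t x)
  let S : ℝ≥0 → E →L[ℂ] E := fun t =>
    LinearMap.mkContinuous
      { toFun := S0 t
        map_add' := fun x y => tendsto_nhds_unique (hS0 t (x + y))
          (((hS0 t x).add (hS0 t y)).congr fun n => (map_add _ _ _).symm)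
        map_smul' := fun c x => tendsto_nhds_unique (hS0 t (c • x))
          (((hS0 t x).const_smul c).congr fun n => (map_smul _ _ _).symm) }
      1 fun x => by rw [one_mul]; exact hSn t x
  have hS : ∀ t x, Tendsto (fun n => T n t x) atTop (𝓝 (S t x)) := hS0
  refine ⟨S, ?_, fun s t => ?_, hSn, fun x z t => ?_⟩
  · ext x
    refine tendsto_nhds_unique (hS 0 x) ?_
    simp [hT]
  · ext x
    refine tendsto_nhds_unique (hS (s + t) x) ?_
    have e : ∀ n, T n (s + t) x = T n s (T n t x - S t x) + T n s (S t x) := by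
      intro n
      let _ : NormedAlgebra ℚ (E →L[ℂ] E) := NormedAlgebra.restrictScalars ℚ ℂ _
      rw [map_sub, sub_add_cancel]
      simp only [hT, NNReal.coe_add, add_smul]
      rw [NormedSpace.exp_add_of_commute (((Commute.refl _).smul_left _).smul_right _)]
      rfl
    simp only [e]
    have h0 : Tendsto (fun n => T n s (T n t x - S t x)) atTop (𝓝 0) :=
      squeeze_zero_norm (fun n => hTn n s _) (tendsto_iff_norm_sub_tendsto_zero.1 (hS t x))
    simpa using h0.add (hS s (S t x))
  · have h1 : Tendsto (fun n => ‖T n t x - x - ((t : ℝ) : ℂ) • B n x‖) atTop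
        (𝓝 ‖S t x - x - ((t : ℝ) : ℂ) • L x‖) :=
      (((hS t x).sub_const _).sub ((hBlim x).const_smul _)).norm
    have h2 : Tendsto (fun n => (2 * ‖B n x - z‖ + (t : ℝ) * ‖L z‖) * t) atTop
        (𝓝 ((2 * ‖L x - z‖ + (t : ℝ) * ‖L z‖) * t)) :=
      (((((hBlim x).sub_const _).norm).const_mul 2).add_const _).mul_const _
    refine le_of_tendsto_of_tendsto' h1 h2 fun n => ?_
    have h3 := norm_exp_smul_sub_self_sub_le (hBd n) t.2 (x : E) (z : E)
    refine h3.trans (mul_le_mul_of_nonneg_right ?_ t.2)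
    exact add_le_add le_rfl (mul_le_mul_of_nonneg_left (hBb n z) t.2)

/-- **Lumer–Phillips theorem** in a Hilbert space: a quasi-dissipative operator with
`λ₀ - L` onto for one `λ₀ > ω` generates a `C₀`-semigroup. -/
theorem _root_.LinearPMap.exists_c0Semigroup [CompleteSpace E] {A : E →ₗ.[ℂ] E} {w l : ℝ}
    (hd : ∀ x : A.domain, (inner ℂ (x : E) (A x)).re ≤ w * ‖(x : E)‖ ^ 2) (hl : w < l)
    (hs : ∀ y, ∃ x : A.domain, (l : ℂ) • (x : E) - A x = y) :
    ∃ T : C0Semigroup E, T.generator = A := by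
  -- `A - w` is dissipative; its semigroup is then multiplied by `exp (w t)`
  let L : A.domain →ₗ[ℂ] E := A.toFun - (w : ℂ) • A.domain.subtype
  have hL : ∀ x, L x = A x - (w : ℂ) • (x : E) := fun x => rfl
  have hself : ∀ x : E, (inner ℂ x x).re = ‖x‖ ^ 2 := fun x => inner_self_eq_norm_sq (𝕜 := ℂ) x
  have hLd : ∀ x : A.domain, (inner ℂ (x : E) (L x)).re ≤ 0 := fun x => by
    rw [hL, inner_sub_right, inner_smul_right, Complex.sub_re, Complex.re_ofReal_mul, hself]
    linarith [hd x]
  have hLs : ∀ y, ∃ x : A.domain, ((l - w : ℝ) : ℂ) • (x : E) - L x = y := fun y => by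
    obtain ⟨x, hx⟩ := hs y
    refine ⟨x, ?_⟩
    rw [hL, ← hx]
    push_cast
    module
  have hdense := dense_domain hLd (sub_pos.2 hl) hLs
  obtain ⟨S, hS0, hSadd, hSn, hSe⟩ := exists_contraction_semigroup hLd (sub_pos.2 hl) hLs
  have hexp : Continuous fun t : ℝ≥0 => ((Real.exp (w * t) : ℝ) : ℂ) := by fun_prop
  have hcoe : Tendsto (fun t : ℝ≥0 => (t : ℝ)) (𝓝[>] 0) (𝓝 0) :=
    (NNReal.continuous_coe.tendsto' 0 0 rfl).mono_left nhdsWithin_le_nhds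
  -- the difference quotient at a point of the domain
  have hquot : ∀ x : A.domain, Tendsto (fun t : ℝ≥0 => ((t : ℝ) : ℂ)⁻¹ • (S t x - x)) (𝓝[>] 0)
      (𝓝 (L x)) := by
    intro x
    rw [Metric.tendsto_nhds]
    intro ε hε
    obtain ⟨z, hz, hzD⟩ := Metric.dense_iff.1 hdense (L x) (ε / 4) (by positivity)
    rw [Metric.mem_ball, dist_comm, dist_eq_norm] at hz
    have h1 : ∀ᶠ t : ℝ≥0 in 𝓝[>] 0, (t : ℝ) * ‖L ⟨z, hzD⟩‖ < ε / 2 := by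
      have := hcoe.mul_const ‖L ⟨z, hzD⟩‖
      rw [zero_mul] at this
      exact this.eventually (gt_mem_nhds (by positivity))
    filter_upwards [h1, self_mem_nhdsWithin] with t ht htpos
    have htpos' : (0 : ℝ) < t := htpos
    have h2 := hSe x ⟨z, hzD⟩ t
    have e : ((t : ℝ) : ℂ)⁻¹ • (S t x - x) - L x =
        ((t : ℝ) : ℂ)⁻¹ • (S t x - x - ((t : ℝ) : ℂ) • L x) := by
      rw [smul_sub _ _ (((t : ℝ) : ℂ) • L x), inv_smul_smul₀ (by exact_mod_cast htpos'.ne')]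
    rw [dist_eq_norm, e, norm_smul, norm_inv, Complex.norm_real, Real.norm_eq_abs,
      abs_of_pos htpos', inv_mul_eq_div, div_lt_iff₀ htpos']
    refine h2.trans_lt (mul_lt_mul_of_pos_right ?_ htpos')
    simp only
    linarith
  have hcont : ∀ x, Tendsto (fun t : ℝ≥0 => S t x) (𝓝[>] 0) (𝓝 x) := by
    have hD : ∀ x : A.domain, Tendsto (fun t : ℝ≥0 => S t x) (𝓝[>] 0) (𝓝 (x : E)) := by
      intro x
      have h1 : Tendsto (fun t : ℝ≥0 => ((t : ℝ) : ℂ)) (𝓝[>] 0) (𝓝 0) := by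
        simpa using! (Complex.continuous_ofReal.tendsto 0).comp hcoe
      have h2 := (h1.smul (hquot x)).add_const (x : E)
      rw [zero_smul, zero_add] at h2
      refine h2.congr' ?_
      filter_upwards [self_mem_nhdsWithin] with t ht
      have htpos' : (0 : ℝ) < t := ht
      rw [smul_inv_smul₀ (by exact_mod_cast htpos'.ne'), sub_add_cancel]
    intro x
    rw [Metric.tendsto_nhds]
    intro ε hε
    obtain ⟨z, hz, hzD⟩ := Metric.dense_iff.1 hdense x (ε / 3) (by positivity)
    rw [Metric.mem_ball, dist_comm, dist_eq_norm] at hz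
    filter_upwards [Metric.tendsto_nhds.1 (hD ⟨z, hzD⟩) (ε / 3) (by positivity)] with t ht
    rw [dist_eq_norm] at ht ⊢
    have e : S t x - x = S t (x - z) + (S t z - z) - (x - z) := by rw [map_sub]; abel
    rw [e]
    have h3 := norm_sub_le (S t (x - z) + (S t z - z)) (x - z)
    have h4 := norm_add_le (S t (x - z)) (S t z - z)
    have h5 := hSn t (x - z)
    linarith
  let T : C0Semigroup E :=
    { op := fun t => ((Real.exp (w * t) : ℝ) : ℂ) • S t
      op_zero := by simp [hS0]
      op_add := fun s t => by
        rw [hSadd, ContinuousLinearMap.smul_comp, ContinuousLinearMap.comp_smul, smul_smul,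
          ← Complex.ofReal_mul, ← Real.exp_add, NNReal.coe_add, mul_add]
      strongly_continuous := fun x => by
        have h1 := ((hexp.tendsto 0).mono_left nhdsWithin_le_nhds).smul (hcont x)
        simpa using h1 }
  have hTop : ∀ t x, T.op t x = ((Real.exp (w * t) : ℝ) : ℂ) • S t x := fun t x => rfl
  have hexpq : Tendsto (fun t : ℝ≥0 => (((t : ℝ)⁻¹ * (Real.exp (w * t) - 1) : ℝ) : ℂ)) (𝓝[>] 0)
      (𝓝 (w : ℂ)) := by
    refine (Complex.continuous_ofReal.tendsto w).comp ?_
    have h1 : HasDerivAt (fun t : ℝ => Real.exp (w * t)) w 0 := by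
      simpa using ((hasDerivAt_id (0 : ℝ)).const_mul w).exp
    have h2 := h1.tendsto_slope_zero_right
    have h3 : Tendsto (fun t : ℝ≥0 => (t : ℝ)) (𝓝[>] 0) (𝓝[>] 0) := by
      refine tendsto_nhdsWithin_iff.2 ⟨hcoe, ?_⟩
      filter_upwards [self_mem_nhdsWithin] with t ht
      exact ht
    simpa using! h2.comp h3
  have hgen : ∀ x : A.domain, T.HasGenValue x (A x) := by
    intro x
    have h1 := (((hexp.tendsto 0).mono_left nhdsWithin_le_nhds).smul (hquot x)).add
      (hexpq.smul_const (x : E))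
    have e : ((Real.exp (w * ((0 : ℝ≥0) : ℝ)) : ℝ) : ℂ) • L x + (w : ℂ) • (x : E) = A x := by
      rw [hL]; simp
    rw [e] at h1
    refine h1.congr fun t => ?_
    rw [hTop]
    push_cast
    module
  -- the generator is again quasi-dissipative, so `l - T.generator` is injective
  have hdiss : ∀ x y, T.HasGenValue x y → (inner ℂ x y).re ≤ w * ‖x‖ ^ 2 := by
    intro x y hxy
    have h1 : Tendsto (fun t : ℝ≥0 => (inner ℂ x (((t : ℝ) : ℂ)⁻¹ • (T.op t x - x))).re) (𝓝[>] 0)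
        (𝓝 (inner ℂ x y).re) :=
      (Complex.continuous_re.tendsto _).comp (Tendsto.inner tendsto_const_nhds hxy)
    have h2 : Tendsto (fun t : ℝ≥0 => ((t : ℝ)⁻¹ * (Real.exp (w * t) - 1)) * ‖x‖ ^ 2) (𝓝[>] 0)
        (𝓝 (w * ‖x‖ ^ 2)) := by
      have := (Complex.continuous_re.tendsto _).comp hexpq
      simp only [Complex.ofReal_re] at this
      exact this.mul_const _
    refine le_of_tendsto_of_tendsto' h1 h2 fun t => ?_
    rw [← Complex.ofReal_inv, inner_smul_right, Complex.re_ofReal_mul, mul_assoc]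
    refine mul_le_mul_of_nonneg_left ?_ (by positivity)
    rw [inner_sub_right, Complex.sub_re, hself, hTop, inner_smul_right, Complex.re_ofReal_mul]
    have h3 : (inner ℂ x (S t x)).re ≤ ‖x‖ * ‖S t x‖ := re_inner_le_norm (𝕜 := ℂ) _ _
    have h4 := mul_le_mul_of_nonneg_left (hSn t x) (norm_nonneg x)
    have h5 := mul_le_mul_of_nonneg_left (h3.trans h4) (Real.exp_pos (w * t)).le
    nlinarith
  have hmem : ∀ x y, T.HasGenValue x y → ∃ h : x ∈ A.domain, A ⟨x, h⟩ = y := by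
    intro x y hxy
    obtain ⟨z, hz⟩ := hs ((l : ℂ) • x - y)
    have h1 := hxy.add ((hgen z).smul (-1))
    have h2 := hdiss _ _ h1
    have h3 : y + (-1 : ℂ) • A z = (l : ℂ) • (x + (-1 : ℂ) • (z : E)) := by
      have : A z = (l : ℂ) • (z : E) - ((l : ℂ) • x - y) := by rw [← hz]; abel
      rw [this]; module
    rw [h3, inner_smul_right, Complex.re_ofReal_mul, hself] at h2
    have h4 : ‖x + (-1 : ℂ) • (z : E)‖ ^ 2 = 0 := le_antisymm (by nlinarith) (sq_nonneg _)
    have h5 : x = z := by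
      have := norm_eq_zero.1 (pow_eq_zero_iff two_ne_zero |>.1 h4)
      rwa [neg_one_smul, ← sub_eq_add_neg, sub_eq_zero] at this
    subst h5
    exact ⟨z.2, (hgen z).unique hxy⟩
  refine ⟨T, LinearPMap.ext ?_ ?_⟩
  · ext x
    exact ⟨fun ⟨y, hy⟩ => (hmem x y hy).1, fun hx => ⟨_, hgen ⟨x, hx⟩⟩⟩
  · intro x h1 h2
    exact (T.hasGenValue_generator ⟨x, h1⟩).unique (hgen ⟨x, h2⟩)
end Dissipative

/-! ### Indefinite integrals and integration by parts -/

/-- `F` is an indefinite integral of the locally integrable function `f` on the line. -/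
structure IsPrimitive {E : Type*} [NormedAddCommGroup E] [NormedSpace ℝ E] (F f : ℝ → E) :
    Prop where
  locallyIntegrable : LocallyIntegrable f volume
  sub_eq : ∀ x y, F y - F x = ∫ t in x..y, f t

namespace IsPrimitive

section General

variable {E : Type*} [NormedAddCommGroup E] [NormedSpace ℝ E] {F f : ℝ → E}

theorem intervalIntegrable (h : IsPrimitive F f) (a b : ℝ) : IntervalIntegrable f volume a b :=
  (h.locallyIntegrable.integrableOn_isCompact isCompact_uIcc).intervalIntegrable

theorem continuous (h : IsPrimitive F f) : Continuous F := by
  have e : F = fun x => F 0 + ∫ t in (0 : ℝ)..x, f t := by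
    ext x; rw [← h.sub_eq]; abel
  rw [e]
  exact continuous_const.add
    (intervalIntegral.continuous_primitive (fun a b => h.intervalIntegrable a b) 0)

theorem intervalIntegral (hf : LocallyIntegrable f volume) (c : E) (a : ℝ) :
    IsPrimitive (fun x => c + ∫ t in a..x, f t) f where
  locallyIntegrable := hf
  sub_eq x y := by
    have hi : ∀ a b : ℝ, IntervalIntegrable f volume a b := fun a b =>
      (hf.integrableOn_isCompact isCompact_uIcc).intervalIntegrable
    rw [add_sub_add_left_eq_sub, intervalIntegral.integral_interval_sub_left (hi _ _) (hi _ _)]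

theorem clm_comp {G : Type*} [NormedAddCommGroup G] [NormedSpace ℝ G] [CompleteSpace E]
    [CompleteSpace G] (h : IsPrimitive F f) (T : E →L[ℝ] G) :
    IsPrimitive (fun x => T (F x)) (fun x => T (f x)) where
  locallyIntegrable := fun x => by
    obtain ⟨U, hU, hi⟩ := h.locallyIntegrable x
    exact ⟨U, hU, T.integrable_comp hi⟩
  sub_eq x y := by
    rw [← map_sub, h.sub_eq, T.intervalIntegral_comp_comm (h.intervalIntegrable x y)]

theorem of_contDiff [CompleteSpace E] {n : ℕ∞ω} (hn : 1 ≤ n) (hF : ContDiff ℝ n F) :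
    IsPrimitive F (deriv F) where
  locallyIntegrable := (hF.continuous_deriv hn).locallyIntegrable
  sub_eq x y := by
    rw [intervalIntegral.integral_deriv_eq_sub
      (fun z _ => (hF.differentiable (by intro h; simp [h] at hn)).differentiableAt)
      ((hF.continuous_deriv hn).intervalIntegrable _ _)]

end General

/-- Integration by parts for real absolutely continuous functions. -/
theorem integral_mul_real {F f G g : ℝ → ℝ} (hF : IsPrimitive F f) (hG : IsPrimitive G g)
    (a b : ℝ) :
    ∫ x in a..b, (f x * G x + F x * g x) = F b * G b - F a * G a := by
  have hac : ∀ {F f : ℝ → ℝ}, IsPrimitive F f → AbsolutelyContinuousOnInterval F a b := by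
    intro F f h
    have e : F = (fun _ => F a) + fun x => ∫ t in a..x, f t := by
      ext x; rw [Pi.add_apply, ← h.sub_eq]; abel
    rw [e]
    exact (contDiff_const.contDiffOn.absolutelyContinuousOnInterval).add
      ((h.intervalIntegrable a b).absolutelyContinuousOnInterval_intervalIntegral (by simp))
  have hder : ∀ {F f : ℝ → ℝ}, IsPrimitive F f → ∀ᵐ x, deriv F x = f x := by
    intro F f h
    filter_upwards [_root_.LocallyIntegrable.ae_hasDerivAt_integral h.locallyIntegrable] with x hx
    have e : F = fun x => F a + ∫ t in a..x, f t := by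
      ext x; rw [← h.sub_eq]; abel
    rw [e]
    exact ((hx a).const_add (F a)).deriv
  rw [← (hac hF).integral_deriv_mul_eq_sub (hac hG)]
  refine intervalIntegral.integral_congr_ae ?_
  filter_upwards [hder hF, hder hG] with x h1 h2 _
  rw [h1, h2]

theorem intervalIntegrable_mul {F f G g : ℝ → ℂ} (hF : IsPrimitive F f) (hG : IsPrimitive G g)
    (a b : ℝ) : IntervalIntegrable (fun x => f x * G x + F x * g x) volume a b :=
  ((hF.intervalIntegrable a b).mul_continuousOn hG.continuous.continuousOn).add
    ((hG.intervalIntegrable a b).continuousOn_mul hF.continuous.continuousOn)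

/-- Integration by parts for complex absolutely continuous functions. -/
theorem integral_mul {F f G g : ℝ → ℂ} (hF : IsPrimitive F f) (hG : IsPrimitive G g)
    (a b : ℝ) :
    ∫ x in a..b, (f x * G x + F x * g x) = F b * G b - F a * G a := by
  have hF1 := hF.clm_comp Complex.reCLM
  have hF2 := hF.clm_comp Complex.imCLM
  have hG1 := hG.clm_comp Complex.reCLM
  have hG2 := hG.clm_comp Complex.imCLM
  have hi : ∀ {F f G g : ℝ → ℝ}, IsPrimitive F f → IsPrimitive G g →
      IntervalIntegrable (fun x => f x * G x + F x * g x) volume a b := fun hF hG =>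
    ((hF.intervalIntegrable a b).mul_continuousOn hG.continuous.continuousOn).add
      ((hG.intervalIntegrable a b).continuousOn_mul hF.continuous.continuousOn)
  have hint := hF.intervalIntegrable_mul hG a b
  simp only [Complex.reCLM_apply, Complex.imCLM_apply] at hF1 hF2 hG1 hG2
  apply Complex.ext
  · rw [← Complex.reCLM_apply, ← Complex.reCLM.intervalIntegral_comp_comm hint]
    have e : ∀ x, Complex.reCLM (f x * G x + F x * g x) =
        ((f x).re * (G x).re + (F x).re * (g x).re) -
          ((f x).im * (G x).im + (F x).im * (g x).im) := fun x => by simp; ring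
    simp only [e]
    rw [intervalIntegral.integral_sub (hi hF1 hG1) (hi hF2 hG2), hF1.integral_mul_real hG1,
      hF2.integral_mul_real hG2]
    simp; ring
  · rw [← Complex.imCLM_apply, ← Complex.imCLM.intervalIntegral_comp_comm hint]
    have e : ∀ x, Complex.imCLM (f x * G x + F x * g x) =
        ((f x).re * (G x).im + (F x).re * (g x).im) +
          ((f x).im * (G x).re + (F x).im * (g x).re) := fun x => by simp; ring
    simp only [e]
    rw [intervalIntegral.integral_add (hi hF1 hG2) (hi hF2 hG1), hF1.integral_mul_real hG2,
      hF2.integral_mul_real hG1]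
    simp; ring

theorem conj {F f : ℝ → ℂ} (h : IsPrimitive F f) :
    IsPrimitive (fun x => starRingEnd ℂ (F x)) (fun x => starRingEnd ℂ (f x)) :=
  h.clm_comp Complex.conjCLE.toContinuousLinearMap

/-- An indefinite integral of `f` has weak derivative `f`. -/
theorem integral_deriv_smul {F f : ℝ → ℂ} (h : IsPrimitive F f) {φ : ℝ → ℝ}
    (hφ : ContDiff ℝ ∞ φ) (hs : HasCompactSupport φ) :
    ∫ x, deriv φ x • F x = - ∫ x, φ x • f x := by
  have hd : Continuous (deriv φ) := hφ.continuous_deriv (by simp)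
  have hprim : IsPrimitive (fun x => ((φ x : ℝ) : ℂ)) (fun x => ((deriv φ x : ℝ) : ℂ)) :=
    (of_contDiff (n := ∞) (by simp) hφ).clm_comp Complex.ofRealCLM
  obtain ⟨R, hR⟩ := hs.isCompact.isBounded.subset_ball 0
  have hout : ∀ x, x ∉ Ioc (-R) R → x ∉ tsupport φ := by
    intro x hx hx'
    have := hR hx'
    rw [Metric.mem_ball, dist_zero_right, Real.norm_eq_abs, abs_lt] at this
    exact hx ⟨this.1, this.2.le⟩
  have hint : Integrable fun x => deriv φ x • F x :=
    h.continuous.locallyIntegrable.integrable_smul_left_of_hasCompactSupport hd hs.deriv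
  have hint' : Integrable fun x => φ x • f x :=
    h.locallyIntegrable.integrable_smul_left_of_hasCompactSupport hφ.continuous hs
  rw [eq_neg_iff_add_eq_zero, ← integral_add hint hint',
    ← setIntegral_eq_integral_of_forall_compl_eq_zero (s := Ioc (-R) R)]
  · by_cases hRR : -R ≤ R
    · rw [← intervalIntegral.integral_of_le hRR]
      have h1 := hprim.integral_mul h (-R) R
      have h2 : φ (-R) = 0 := image_eq_zero_of_notMem_tsupport (hout _ (by simp))
      have h3 : φ R = 0 := image_eq_zero_of_notMem_tsupport fun hx' => by
        have := hR hx'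
        rw [Metric.mem_ball, dist_zero_right, Real.norm_eq_abs] at this
        exact (le_abs_self R).not_gt this
      rw [h2, h3] at h1
      simpa using h1
    · rw [Ioc_eq_empty (by linarith)]; simp
  · intro x hx
    have hx' := hout x hx
    have h1 : φ x = 0 := image_eq_zero_of_notMem_tsupport hx'
    have h2 : deriv φ x = 0 :=
      image_eq_zero_of_notMem_tsupport fun h => hx' (tsupport_deriv_subset h)
    simp [h1, h2]

end IsPrimitive

/-! ### The du Bois-Reymond lemma -/

/-- A test function of mean zero on an interval is the derivative of a test function there. -/
theorem exists_test_deriv_eq {Ω : Set ℝ} (hΩ : Ω.OrdConnected) {ψ : ℝ → ℝ}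
    (hψ : ContDiff ℝ ∞ ψ) (hs : HasCompactSupport ψ) (hsub : tsupport ψ ⊆ Ω)
    (hmean : ∫ x, ψ x = 0) :
    ∃ φ : ℝ → ℝ, ContDiff ℝ ∞ φ ∧ HasCompactSupport φ ∧ tsupport φ ⊆ Ω ∧ deriv φ = ψ := by
  rcases (tsupport ψ).eq_empty_or_nonempty with he | hne
  · have h0 : ψ = 0 := tsupport_eq_empty_iff.1 he
    refine ⟨0, contDiff_const, HasCompactSupport.zero, ?_, ?_⟩
    · simp
    · rw [h0]; ext x; simp
  obtain ⟨a, ha⟩ := hs.isCompact.exists_isLeast hne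
  obtain ⟨b, hb⟩ := hs.isCompact.exists_isGreatest hne
  have hout : ∀ x, x ∉ Icc a b → ψ x = 0 := fun x hx =>
    image_eq_zero_of_notMem_tsupport fun h => hx ⟨ha.2 h, hb.2 h⟩
  have hab : a ≤ b := ha.2 hb.1
  have hder : ∀ x, HasDerivAt (fun x => ∫ t in a..x, ψ t) (ψ x) x := fun x =>
    (hψ.continuous).integral_hasStrictDerivAt a x |>.hasDerivAt
  have hdeq : deriv (fun x => ∫ t in a..x, ψ t) = ψ := funext fun x => (hder x).deriv
  have hzero : ∀ x, x ∉ Icc a b → ∫ t in a..x, ψ t = 0 := by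
    intro x hx
    have h1 : ∀ y, b < y → ∫ t in a..y, ψ t = 0 := by
      intro y hy
      rw [intervalIntegral.integral_of_le (hab.trans hy.le), ← hmean]
      by_cases hψa : ψ a = 0
      · refine setIntegral_eq_integral_of_forall_compl_eq_zero fun t ht => ?_
        by_cases hta : t = a
        · rw [hta, hψa]
        · exact hout t fun h => ht ⟨lt_of_le_of_ne h.1 (Ne.symm hta), h.2.trans hy.le⟩
      · rw [← integral_Icc_eq_integral_Ioc]
        exact setIntegral_eq_integral_of_forall_compl_eq_zero fun t ht =>
          hout t fun h => ht ⟨h.1, h.2.trans hy.le⟩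
    by_cases hxb : b < x
    · exact h1 x hxb
    · have hxa : x < a := by
        by_contra h
        exact hx ⟨not_lt.1 h, not_lt.1 hxb⟩
      rw [intervalIntegral.integral_symm, intervalIntegral.integral_of_le hxa.le,
        integral_Ioc_eq_integral_Ioo, setIntegral_eq_zero_of_forall_eq_zero, neg_zero]
      exact fun t ht => hout t fun h => h.1.not_gt ht.2
  have hts : tsupport (fun x => ∫ t in a..x, ψ t) ⊆ Icc a b := by
    refine closure_minimal (fun x hx => ?_) isClosed_Icc
    by_contra h
    exact hx (hzero x h)
  refine ⟨fun x => ∫ t in a..x, ψ t, ?_, HasCompactSupport.of_support_subset_isCompact isCompact_Icc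
    (subset_closure.trans hts), hts.trans (hΩ.out (hsub ha.1) (hsub hb.1)), hdeq⟩
  rw [contDiff_infty_iff_deriv, hdeq]
  exact ⟨fun x => (hder x).differentiableAt, hψ⟩

theorem exists_test_integral_eq_one {Ω : Set ℝ} (ho : IsOpen Ω) (hne : Ω.Nonempty) :
    ∃ ψ : ℝ → ℝ, ContDiff ℝ ∞ ψ ∧ HasCompactSupport ψ ∧ tsupport ψ ⊆ Ω ∧ ∫ x, ψ x = 1 := by
  obtain ⟨x, hx⟩ := hne
  obtain ⟨r, hr, hball⟩ := Metric.isOpen_iff.1 ho x hx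
  let β : ContDiffBump x := ⟨r / 4, r / 2, by positivity, by linarith⟩
  refine ⟨β.normed volume, β.contDiff_normed, β.hasCompactSupport_normed, ?_, β.integral_normed⟩
  rw [β.tsupport_normed_eq]
  exact (Metric.closedBall_subset_ball (by show r / 2 < r; linarith)).trans hball

/-- The **du Bois-Reymond lemma** on an interval. -/
theorem exists_ae_eq_const_of_integral_deriv_smul_eq_zero {Ω : Set ℝ} (ho : IsOpen Ω)
    (hc : Ω.OrdConnected) (hne : Ω.Nonempty) {h : ℝ → ℂ} (hl : LocallyIntegrable h volume)
    (hz : ∀ φ : ℝ → ℝ, ContDiff ℝ ∞ φ → HasCompactSupport φ → tsupport φ ⊆ Ω →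
      ∫ x, deriv φ x • h x = 0) :
    ∃ c : ℂ, ∀ᵐ x, x ∈ Ω → h x = c := by
  obtain ⟨ψ₀, h1, h2, h3, h4⟩ := exists_test_integral_eq_one ho hne
  refine ⟨∫ x, ψ₀ x • h x, ?_⟩
  have key := ho.ae_eq_zero_of_integral_contDiff_smul_eq_zero
    (f := fun x => h x - ∫ x, ψ₀ x • h x) (μ := volume)
    ((hl.sub (locallyIntegrable_const _)).locallyIntegrableOn Ω) ?_
  · filter_upwards [key] with x hx hxΩ using sub_eq_zero.1 (hx hxΩ)
  intro ψ hψ hs hsub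
  -- subtract a multiple of the fixed test function `ψ₀` to get mean zero
  set m : ℝ := ∫ x, ψ x with hm
  have i1 : Integrable ψ := hψ.continuous.integrable_of_hasCompactSupport hs
  have i2 : Integrable ψ₀ := h1.continuous.integrable_of_hasCompactSupport h2
  have j1 := hl.integrable_smul_left_of_hasCompactSupport hψ.continuous hs
  have j2 := hl.integrable_smul_left_of_hasCompactSupport h1.continuous h2
  have hmul : HasCompactSupport fun x => m * ψ₀ x := h2.mul_left
  have hsub2 : tsupport (fun x => ψ x - m * ψ₀ x) ⊆ Ω := by
    refine (tsupport_sub ψ fun x => m * ψ₀ x).trans (union_subset hsub ?_)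
    exact (tsupport_mul_subset_right).trans h3
  obtain ⟨φ, k1, k2, k3, k4⟩ := exists_test_deriv_eq hc (ψ := fun x => ψ x - m * ψ₀ x)
    (hψ.sub (contDiff_const.mul h1)) (hs.sub hmul) hsub2
    (by rw [integral_sub i1 (i2.const_mul m), integral_const_mul, h4, mul_one, sub_self])
  have k5 := hz φ k1 k2 k3
  rw [k4] at k5
  have e1 : (fun x => (ψ x - m * ψ₀ x) • h x) = fun x => ψ x • h x - m • (ψ₀ x • h x) := by
    ext x; rw [sub_smul, mul_smul]
  have j3 : Integrable fun x => m • (ψ₀ x • h x) := j2.smul m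
  rw [e1, integral_sub j1 j3, integral_smul] at k5
  have e2 : (fun x => ψ x • (h x - ∫ x, ψ₀ x • h x)) =
      fun x => ψ x • h x - ψ x • ∫ x, ψ₀ x • h x := by
    ext x; rw [smul_sub]
  rw [e2, integral_sub j1 (i1.smul_const _), integral_smul_const]
  exact k5

/-! ### One-dimensional Sobolev functions -/

namespace WaveHeat

section Sobolev

variable {Ω : TopologicalSpace.Opens ℝ}

theorem locallyIntegrable_indicator (f : L2 Ω) :
    LocallyIntegrable ((Ω : Set ℝ).indicator f) volume :=
  ((memLp_indicator_iff_restrict Ω.isOpen.measurableSet).2 (Lp.memLp f)).locallyIntegrable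
    (by norm_num)

theorem integral_smul_indicator (φ : ℝ → ℝ) (f : ℝ → ℂ) :
    ∫ x, φ x • (Ω : Set ℝ).indicator f x = ∫ x in (Ω : Set ℝ), φ x • f x := by
  rw [← integral_indicator Ω.isOpen.measurableSet]
  congr 1
  ext x
  by_cases hx : x ∈ (Ω : Set ℝ) <;> simp [hx]

theorem setIntegral_smul_eq_integral {φ : ℝ → ℝ} (hΩ : tsupport φ ⊆ (Ω : Set ℝ)) (f : ℝ → ℂ) :
    ∫ x in (Ω : Set ℝ), φ x • f x = ∫ x, φ x • f x :=
  setIntegral_eq_integral_of_forall_compl_eq_zero fun x hx => by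
    rw [image_eq_zero_of_notMem_tsupport fun h => hx (hΩ h), zero_smul]

/-- A function in `L²(Ω)` that agrees on `Ω` with an indefinite integral is weakly
differentiable. -/
theorem isWeakDeriv_of_isPrimitive {f g : L2 Ω} {F k : ℝ → ℂ} (hF : IsPrimitive F k)
    (hf : f =ᵐ[volume.restrict (Ω : Set ℝ)] F) (hg : g =ᵐ[volume.restrict (Ω : Set ℝ)] k) :
    IsWeakDeriv f g := by
  intro φ hφ hs hΩ
  have e1 : ∫ x in (Ω : Set ℝ), deriv φ x • f x = ∫ x in (Ω : Set ℝ), deriv φ x • F x :=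
    integral_congr_ae (hf.mono fun x hx => by simp only [hx])
  have e2 : ∫ x in (Ω : Set ℝ), φ x • g x = ∫ x in (Ω : Set ℝ), φ x • k x :=
    integral_congr_ae (hg.mono fun x hx => by simp only [hx])
  rw [e1, e2, setIntegral_smul_eq_integral ((tsupport_deriv_subset).trans hΩ),
    setIntegral_smul_eq_integral hΩ, hF.integral_deriv_smul hφ hs]

/-- On an interval, an `H¹` function is an indefinite integral of its weak derivative. -/
theorem IsWeakDeriv.exists_isPrimitive (hc : (Ω : Set ℝ).OrdConnected)
    (hne : (Ω : Set ℝ).Nonempty) {f g : L2 Ω} (h : IsWeakDeriv f g) :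
    ∃ F, IsPrimitive F ((Ω : Set ℝ).indicator g) ∧ f =ᵐ[volume.restrict (Ω : Set ℝ)] F := by
  have hG := IsPrimitive.intervalIntegral (locallyIntegrable_indicator g) 0 0
  set G : ℝ → ℂ := fun x => 0 + ∫ t in (0 : ℝ)..x, (Ω : Set ℝ).indicator g t with hGdef
  have hz : ∀ φ : ℝ → ℝ, ContDiff ℝ ∞ φ → HasCompactSupport φ → tsupport φ ⊆ (Ω : Set ℝ) →
      ∫ x, deriv φ x • ((Ω : Set ℝ).indicator f x - G x) = 0 := by
    intro φ hφ hs hΩ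
    have hd : Continuous (deriv φ) := hφ.continuous_deriv (by simp)
    have i1 := (locallyIntegrable_indicator f).integrable_smul_left_of_hasCompactSupport hd hs.deriv
    have i2 := hG.continuous.locallyIntegrable.integrable_smul_left_of_hasCompactSupport
      (μ := volume) hd hs.deriv
    simp only [smul_sub]
    rw [integral_sub i1 i2, integral_smul_indicator, h φ hφ hs hΩ, hG.integral_deriv_smul hφ hs,
      integral_smul_indicator, sub_self]
  obtain ⟨c, hcon⟩ := exists_ae_eq_const_of_integral_deriv_smul_eq_zero Ω.isOpen hc hne
    ((locallyIntegrable_indicator f).sub hG.continuous.locallyIntegrable) hz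
  refine ⟨fun x => c + ∫ t in (0 : ℝ)..x, (Ω : Set ℝ).indicator g t,
    IsPrimitive.intervalIntegral (locallyIntegrable_indicator g) c 0, ?_⟩
  rw [EventuallyEq, ae_restrict_iff' Ω.isOpen.measurableSet]
  filter_upwards [hcon] with x hx hxΩ
  have := hx hxΩ
  rw [Pi.sub_apply, indicator_of_mem hxΩ, hGdef] at this
  simp only [zero_add] at this
  rw [← this, sub_add_cancel]

theorem HasBoundaryValue.unique {f : L2 Ω} {a : ℝ} {c d : ℂ} (ha : a ∈ closure (Ω : Set ℝ))
    (hc : HasBoundaryValue f a c) (hd : HasBoundaryValue f a d) : c = d := by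
  obtain ⟨F, hF, hf, rfl⟩ := hc
  obtain ⟨G, hG, hg, rfl⟩ := hd
  have h1 : EqOn F G (Ω : Set ℝ) := Measure.eqOn_open_of_ae_eq (hf.symm.trans hg) Ω.isOpen
    (hF.mono subset_closure) (hG.mono subset_closure)
  exact h1.of_subset_closure hF hG subset_closure subset_rfl ha

theorem hasBoundaryValue_of_continuous {f : L2 Ω} {F : ℝ → ℂ} (hF : Continuous F)
    (hf : f =ᵐ[volume.restrict (Ω : Set ℝ)] F) (a : ℝ) : HasBoundaryValue f a (F a) :=
  ⟨F, hF.continuousOn, hf, rfl⟩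

theorem memLp_test {φ : ℝ → ℝ} (hφ : Continuous φ) (hs : HasCompactSupport φ) :
    MemLp (fun x => (φ x : ℂ)) 2 (volume.restrict (Ω : Set ℝ)) :=
  ((hφ.memLp_of_hasCompactSupport (μ := volume) hs).restrict _).ofReal

/-- The restriction to `Ω` of a continuous function with compact support in `ℝ` (not
necessarily in `Ω`), as an element of `L²(Ω)`. -/
noncomputable def testL2 (Ω : TopologicalSpace.Opens ℝ) {φ : ℝ → ℝ} (hφ : Continuous φ)
    (hs : HasCompactSupport φ) : L2 Ω :=
  (memLp_test hφ hs).toLp _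

theorem coeFn_testL2 {φ : ℝ → ℝ} (hφ : Continuous φ) (hs : HasCompactSupport φ) :
    testL2 Ω hφ hs =ᵐ[volume.restrict (Ω : Set ℝ)] fun x => (φ x : ℂ) :=
  MemLp.coeFn_toLp _

theorem inner_testL2 {φ : ℝ → ℝ} (hφ : Continuous φ) (hs : HasCompactSupport φ) (f : L2 Ω) :
    inner ℂ (testL2 Ω hφ hs) f = ∫ x in (Ω : Set ℝ), φ x • f x := by
  rw [L2.inner_def]
  refine integral_congr_ae ((coeFn_testL2 hφ hs).mono fun x hx => ?_)
  simp only [hx, RCLike.inner_apply, Complex.conj_ofReal, Complex.real_smul]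
  ring

/-- Weak differentiability is a system of orthogonality relations; in particular `H¹(Ω)` is
closed in `L²(Ω) × L²(Ω)`. -/
theorem isWeakDeriv_iff_inner {f g : L2 Ω} :
    IsWeakDeriv f g ↔ ∀ (φ : ℝ → ℝ) (hφ : ContDiff ℝ ∞ φ) (hs : HasCompactSupport φ),
      tsupport φ ⊆ (Ω : Set ℝ) →
        inner ℂ (testL2 Ω (hφ.continuous_deriv (by simp)) hs.deriv) f +
          inner ℂ (testL2 Ω hφ.continuous hs) g = 0 := by
  simp only [inner_testL2, add_eq_zero_iff_eq_neg]
  rfl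

theorem isWeakDeriv_testL2 {φ : ℝ → ℝ} (hφ : ContDiff ℝ ∞ φ) (hs : HasCompactSupport φ) :
    IsWeakDeriv (testL2 Ω hφ.continuous hs)
      (testL2 Ω (hφ.continuous_deriv (by simp)) hs.deriv) :=
  isWeakDeriv_of_isPrimitive
    ((IsPrimitive.of_contDiff (n := ∞) (by simp) hφ).clm_comp Complex.ofRealCLM)
    (coeFn_testL2 _ _) (coeFn_testL2 _ _)

theorem hasBoundaryValue_testL2 {φ : ℝ → ℝ} (hφ : Continuous φ) (hs : HasCompactSupport φ)
    (a : ℝ) : HasBoundaryValue (testL2 Ω hφ hs) a (φ a) :=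
  hasBoundaryValue_of_continuous (F := fun x => (φ x : ℂ)) (by fun_prop) (coeFn_testL2 hφ hs) a

theorem isClosed_H1 : IsClosed (H1 Ω : Set (WithLp 2 (L2 Ω × L2 Ω))) := by
  have e : (H1 Ω : Set (WithLp 2 (L2 Ω × L2 Ω))) =
      {z | IsWeakDeriv z.fst z.snd} := rfl
  rw [e]
  simp only [isWeakDeriv_iff_inner, ofPred_forall]
  refine isClosed_iInter fun φ => isClosed_iInter fun hφ => isClosed_iInter fun hs =>
    isClosed_iInter fun _ => isClosed_eq ?_ continuous_const
  have h1 : Continuous fun z : WithLp 2 (L2 Ω × L2 Ω) => z.fst := WithLp.continuous_fst ..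
  have h2 : Continuous fun z : WithLp 2 (L2 Ω × L2 Ω) => z.snd := WithLp.continuous_snd ..
  fun_prop

instance : CompleteSpace (H1 Ω) := isClosed_H1.completeSpace_coe

end Sobolev

theorem waveI_ordConnected : (waveI : Set ℝ).OrdConnected := ordConnected_Ioo
theorem waveI_nonempty : (waveI : Set ℝ).Nonempty := ⟨-1 / 2, by constructor <;> norm_num⟩
theorem heatI_ordConnected : (heatI : Set ℝ).OrdConnected := ordConnected_Ioi
theorem heatI_nonempty : (heatI : Set ℝ).Nonempty := ⟨1, by show (0 : ℝ) < 1; norm_num⟩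

theorem closure_waveI : closure (waveI : Set ℝ) = Icc (-1) 0 := closure_Ioo (by norm_num)
theorem zero_mem_closure_waveI : (0 : ℝ) ∈ closure (waveI : Set ℝ) := by
  rw [closure_waveI]; constructor <;> norm_num

theorem neg_one_mem_closure_waveI : (-1 : ℝ) ∈ closure (waveI : Set ℝ) := by
  rw [closure_waveI]; constructor <;> norm_num

theorem closure_heatI : closure (heatI : Set ℝ) = Ici 0 := closure_Ioi 0

/-! ### Integration by parts on the wave interval and the heat half-line -/

theorem inner_add_inner_eq {Ω : TopologicalSpace.Opens ℝ} {f f' g g' : L2 Ω} {F G : ℝ → ℂ}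
    (hf : f =ᵐ[volume.restrict (Ω : Set ℝ)] F) (hg : g =ᵐ[volume.restrict (Ω : Set ℝ)] G) :
    inner ℂ f' g + inner ℂ f g' = ∫ x in (Ω : Set ℝ),
      ((starRingEnd ℂ) ((Ω : Set ℝ).indicator f' x) * G x +
        (starRingEnd ℂ) (F x) * (Ω : Set ℝ).indicator g' x) := by
  rw [L2.inner_def, L2.inner_def, ← integral_add (L2.integrable_inner _ _) (L2.integrable_inner _ _)]
  refine integral_congr_ae ?_
  filter_upwards [hf, hg, ae_restrict_mem Ω.isOpen.measurableSet] with x h1 h2 h3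
  rw [h1, h2, indicator_of_mem h3, indicator_of_mem h3, RCLike.inner_apply, RCLike.inner_apply]
  ring

/-- Integration by parts in `H¹(-1, 0)`. -/
theorem inner_add_inner_waveI {f f' g g' : L2 waveI} (hf : IsWeakDeriv f f')
    (hg : IsWeakDeriv g g') {a₀ a₁ b₀ b₁ : ℂ} (ha₀ : HasBoundaryValue f (-1) a₀)
    (ha₁ : HasBoundaryValue f 0 a₁) (hb₀ : HasBoundaryValue g (-1) b₀)
    (hb₁ : HasBoundaryValue g 0 b₁) :
    inner ℂ f' g + inner ℂ f g' = (starRingEnd ℂ) a₁ * b₁ - (starRingEnd ℂ) a₀ * b₀ := by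
  obtain ⟨F, hF, hfF⟩ := hf.exists_isPrimitive waveI_ordConnected waveI_nonempty
  obtain ⟨G, hG, hgG⟩ := hg.exists_isPrimitive waveI_ordConnected waveI_nonempty
  rw [ha₀.unique neg_one_mem_closure_waveI (hasBoundaryValue_of_continuous hF.continuous hfF _),
    ha₁.unique zero_mem_closure_waveI (hasBoundaryValue_of_continuous hF.continuous hfF _),
    hb₀.unique neg_one_mem_closure_waveI (hasBoundaryValue_of_continuous hG.continuous hgG _),
    hb₁.unique zero_mem_closure_waveI (hasBoundaryValue_of_continuous hG.continuous hgG _),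
    inner_add_inner_eq hfF hgG, ← hF.conj.integral_mul hG,
    intervalIntegral.integral_of_le (by norm_num), integral_Ioc_eq_integral_Ioo]
  rfl

/-- Integration by parts in `H¹(0, ∞)`; the boundary term at infinity vanishes because the
product of the two functions is integrable and has a limit. -/
theorem inner_add_inner_heatI {f f' g g' : L2 heatI} (hf : IsWeakDeriv f f')
    (hg : IsWeakDeriv g g') {a b : ℂ} (ha : HasBoundaryValue f 0 a)
    (hb : HasBoundaryValue g 0 b) :
    inner ℂ f' g + inner ℂ f g' = - ((starRingEnd ℂ) a * b) := by
  obtain ⟨F, hF, hfF⟩ := hf.exists_isPrimitive heatI_ordConnected heatI_nonempty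
  obtain ⟨G, hG, hgG⟩ := hg.exists_isPrimitive heatI_ordConnected heatI_nonempty
  have m0 : (0 : ℝ) ∈ closure (heatI : Set ℝ) := by rw [closure_heatI]; simp
  rw [ha.unique m0 (hasBoundaryValue_of_continuous hF.continuous hfF _),
    hb.unique m0 (hasBoundaryValue_of_continuous hG.continuous hgG _),
    inner_add_inner_eq hfF hgG]
  have hi : IntegrableOn (fun x => (starRingEnd ℂ) ((heatI : Set ℝ).indicator f' x) * G x +
      (starRingEnd ℂ) (F x) * (heatI : Set ℝ).indicator g' x) (Ioi 0) volume := by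
    refine ((L2.integrable_inner (𝕜 := ℂ) f' g).add (L2.integrable_inner (𝕜 := ℂ) f g')).congr ?_
    filter_upwards [hfF, hgG, ae_restrict_mem heatI.isOpen.measurableSet] with x h1 h2 h3
    rw [Pi.add_apply, h1, h2, indicator_of_mem h3, indicator_of_mem h3, RCLike.inner_apply,
      RCLike.inner_apply]
    ring
  have hlim := intervalIntegral_tendsto_integral_Ioi 0 hi tendsto_id
  simp only [id_eq, hF.conj.integral_mul hG] at hlim
  have hlim2 := hlim.add_const ((starRingEnd ℂ) (F 0) * G 0)
  simp only [sub_add_cancel] at hlim2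
  have hFG : IntegrableOn (fun x => (starRingEnd ℂ) (F x) * G x) (Ioi 0) volume := by
    refine (L2.integrable_inner (𝕜 := ℂ) f g).congr ?_
    filter_upwards [hfF, hgG] with x h1 h2
    rw [h1, h2, RCLike.inner_apply, mul_comm]
  have hz := IntegrableAtFilter.eq_zero_of_tendsto (μ := volume) (l := atTop)
    ⟨Ioi 0, Ioi_mem_atTop 0, hFG⟩ (fun s hs => by
      obtain ⟨b, hb⟩ := mem_atTop_sets.1 hs
      exact measure_mono_top (fun x hx => hb x hx) (Real.volume_Ici (a := b))) hlim2
  exact eq_neg_of_add_eq_zero_left hz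

theorem IsWeakDeriv.exists_ae_eq_const {Ω : TopologicalSpace.Opens ℝ}
    (hc : (Ω : Set ℝ).OrdConnected) (hne : (Ω : Set ℝ).Nonempty) {f : L2 Ω}
    (h : IsWeakDeriv f 0) : ∃ c, f =ᵐ[volume.restrict (Ω : Set ℝ)] fun _ => c := by
  obtain ⟨c, hcon⟩ := exists_ae_eq_const_of_integral_deriv_smul_eq_zero Ω.isOpen hc hne
    (locallyIntegrable_indicator f) fun φ hφ hs hΩ => by
      rw [integral_smul_indicator, h φ hφ hs hΩ, neg_eq_zero]
      refine integral_eq_zero_of_ae ?_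
      filter_upwards [Lp.coeFn_zero ℂ 2 (volume.restrict (Ω : Set ℝ))] with x hx
      rw [hx]; simp
  refine ⟨c, ?_⟩
  rw [EventuallyEq, ae_restrict_iff' Ω.isOpen.measurableSet]
  filter_upwards [hcon] with x hx hxΩ
  rw [← hx hxΩ, indicator_of_mem hxΩ]

theorem eq_zero_of_ae_eq_const_heatI {f : L2 heatI} {c : ℂ}
    (hc : f =ᵐ[volume.restrict (heatI : Set ℝ)] fun _ => c) : f = 0 := by
  have hm : MemLp (fun _ : ℝ => c) 2 (volume.restrict (heatI : Set ℝ)) :=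
    (memLp_congr_ae hc).1 (Lp.memLp f)
  rw [memLp_const_iff (by norm_num) (by norm_num)] at hm
  have h0 : c = 0 := by
    rcases hm with h | h
    · exact h
    · simp [heatI] at h
  apply Lp.ext
  filter_upwards [hc, Lp.coeFn_zero ℂ 2 (volume.restrict (heatI : Set ℝ))] with x h1 h2
  rw [h1, h2, h0]; rfl

theorem eq_zero_of_isWeakDeriv_zero_heatI {f : L2 heatI} (h : IsWeakDeriv f 0) : f = 0 := by
  obtain ⟨c, hc⟩ := h.exists_ae_eq_const heatI_ordConnected heatI_nonempty
  exact eq_zero_of_ae_eq_const_heatI hc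

theorem eq_zero_of_ae_eq_affine_heatI {f : L2 heatI} {c d : ℂ}
    (hf : f =ᵐ[volume.restrict (heatI : Set ℝ)] fun x => d + x * c) : f = 0 := by
  by_cases hc : c = 0
  · exact eq_zero_of_ae_eq_const_heatI (c := d) (hf.trans (by simp [hc]))
  exfalso
  -- beyond `K` the affine function has modulus at least `1`, so `1` would be square integrable
  set K : ℝ := (1 + ‖d‖) / ‖c‖ with hK
  have hc' : 0 < ‖c‖ := norm_pos_iff.2 hc
  have hK0 : 0 ≤ K := by positivity
  have hsub : Ioi K ⊆ (heatI : Set ℝ) := fun x hx => hK0.trans_lt hx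
  have hm : MemLp (fun x : ℝ => d + x * c) 2 (volume.restrict (Ioi K)) :=
    ((memLp_congr_ae hf).1 (Lp.memLp f)).mono_measure (Measure.restrict_mono hsub le_rfl)
  have h1 : MemLp (fun _ : ℝ => (1 : ℂ)) 2 (volume.restrict (Ioi K)) := by
    refine hm.mono aestronglyMeasurable_const ?_
    filter_upwards [ae_restrict_mem measurableSet_Ioi] with x hx
    have hx' : 1 + ‖d‖ < x * ‖c‖ := (div_lt_iff₀ hc').1 hx
    have h2 : ‖(x : ℂ) * c‖ = x * ‖c‖ := by
      rw [norm_mul, Complex.norm_real, Real.norm_eq_abs, abs_of_pos (hK0.trans_lt hx)]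
    have h3 := norm_sub_le (d + (x : ℂ) * c) d
    rw [add_sub_cancel_left, h2] at h3
    rw [norm_one]
    linarith
  rw [memLp_const_iff (by norm_num) (by norm_num)] at h1
  simp at h1

/-- An `L²(0, ∞)` function with vanishing second weak derivative is affine, hence zero. -/
theorem eq_zero_of_integral_deriv2_smul_eq_zero {f : L2 heatI}
    (h : ∀ φ : ℝ → ℝ, ContDiff ℝ ∞ φ → HasCompactSupport φ → tsupport φ ⊆ (heatI : Set ℝ) →
      ∫ x in (heatI : Set ℝ), deriv (deriv φ) x • f x = 0) : f = 0 := by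
  obtain ⟨ψ₀, h1, h2, h3, h4⟩ := exists_test_integral_eq_one heatI.isOpen heatI_nonempty
  set F : ℝ → ℂ := (heatI : Set ℝ).indicator f with hF
  have hl : LocallyIntegrable F volume := locallyIntegrable_indicator f
  set c : ℂ := ∫ x, deriv ψ₀ x • F x with hc
  have hderiv : ∀ φ : ℝ → ℝ, ContDiff ℝ ∞ φ → HasCompactSupport φ → tsupport φ ⊆ (heatI : Set ℝ) →
      ∫ x, deriv φ x • F x = (∫ x, φ x) • c := by
    intro φ hφ hs hΩ
    set m : ℝ := ∫ x, φ x with hm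
    have i1 : Integrable φ := hφ.continuous.integrable_of_hasCompactSupport hs
    have i2 : Integrable ψ₀ := h1.continuous.integrable_of_hasCompactSupport h2
    have hsub2 : tsupport (fun x => φ x - m * ψ₀ x) ⊆ (heatI : Set ℝ) :=
      (tsupport_sub φ fun x => m * ψ₀ x).trans
        (union_subset hΩ ((tsupport_mul_subset_right).trans h3))
    obtain ⟨χ, k1, k2, k3, k4⟩ := exists_test_deriv_eq heatI_ordConnected
      (hφ.sub (contDiff_const.mul h1)) (hs.sub h2.mul_left) hsub2
      (by rw [integral_sub i1 (i2.const_mul m), integral_const_mul, h4, mul_one, sub_self])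
    have k5 := h χ k1 k2 k3
    have e : ∀ x, deriv (deriv χ) x = deriv φ x - m * deriv ψ₀ x := fun x => by
      rw [k4]
      exact (((hφ.differentiable (by simp) x).hasDerivAt).sub
        (((h1.differentiable (by simp) x).hasDerivAt).const_mul m)).deriv
    rw [← integral_smul_indicator] at k5
    have j1 : Integrable fun x => deriv φ x • F x :=
      hl.integrable_smul_left_of_hasCompactSupport (hφ.continuous_deriv (by simp)) hs.deriv
    have j2 : Integrable fun x => m • (deriv ψ₀ x • F x) :=
      (hl.integrable_smul_left_of_hasCompactSupport (h1.continuous_deriv (by simp)) h2.deriv).smul m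
    simp only [e, sub_smul, mul_smul] at k5
    rw [integral_sub j1 j2, integral_smul, sub_eq_zero] at k5
    exact k5
  have hprim : IsPrimitive (fun x : ℝ => (x : ℂ) * c) fun _ => c :=
    ⟨locallyIntegrable_const c, fun x y => by
      rw [intervalIntegral.integral_const, Complex.real_smul]
      push_cast
      ring⟩
  obtain ⟨d, hd⟩ := exists_ae_eq_const_of_integral_deriv_smul_eq_zero heatI.isOpen
    heatI_ordConnected heatI_nonempty (hl.add hprim.continuous.locallyIntegrable)
    fun φ hφ hs hΩ => by
      have hd : Continuous (deriv φ) := hφ.continuous_deriv (by simp)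
      have i1 := hl.integrable_smul_left_of_hasCompactSupport hd hs.deriv
      have i2 := hprim.continuous.locallyIntegrable.integrable_smul_left_of_hasCompactSupport
        (μ := volume) hd hs.deriv
      simp only [Pi.add_apply, smul_add]
      rw [integral_add i1 i2, hderiv φ hφ hs hΩ, hprim.integral_deriv_smul hφ hs,
        integral_smul_const, add_neg_cancel]
  refine eq_zero_of_ae_eq_affine_heatI (d := d) (c := -c) ?_
  rw [EventuallyEq, ae_restrict_iff' heatI.isOpen.measurableSet]
  filter_upwards [hd] with x hx hxΩ
  rw [← hx hxΩ, Pi.add_apply, hF, indicator_of_mem hxΩ]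
  ring

theorem exists_eq_smul_oneL2_of_isWeakDeriv_zero {f : L2 waveI} (h : IsWeakDeriv f 0) :
    ∃ c : ℂ, f = c • oneL2 ∧ ∀ a, HasBoundaryValue f a c := by
  obtain ⟨c, hc⟩ := h.exists_ae_eq_const waveI_ordConnected waveI_nonempty
  refine ⟨c, ?_, fun a => hasBoundaryValue_of_continuous continuous_const hc a⟩
  apply Lp.ext
  filter_upwards [hc, Lp.coeFn_smul c oneL2, memLp_one.coeFn_toLp] with x h1 h2 h3
  rw [h1, h2, Pi.smul_apply, oneL2, h3, smul_eq_mul, mul_one]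

/-- Integration from the left endpoint gives `H¹(-1, 0)` functions vanishing at `-1`. -/
theorem exists_isWeakDeriv_waveI (g : L2 waveI) :
    ∃ f : L2 waveI, IsWeakDeriv f g ∧ HasBoundaryValue f (-1) 0 := by
  have hF := IsPrimitive.intervalIntegral (locallyIntegrable_indicator g) 0 (-1)
  set F : ℝ → ℂ := fun x => 0 + ∫ t in (-1 : ℝ)..x, (waveI : Set ℝ).indicator g t with hFdef
  have hm : MemLp F 2 (volume.restrict (waveI : Set ℝ)) := by
    have hfin : IsFiniteMeasure (volume.restrict (waveI : Set ℝ)) := ⟨by simp [waveI]⟩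
    obtain ⟨C, hC⟩ := (isCompact_Icc (a := (-1 : ℝ)) (b := 0)).exists_bound_of_continuousOn
      hF.continuous.continuousOn
    refine MemLp.of_bound hF.continuous.aestronglyMeasurable C ?_
    filter_upwards [ae_restrict_mem waveI.isOpen.measurableSet] with x hx
    exact hC x ⟨hx.1.le, hx.2.le⟩
  refine ⟨hm.toLp F, isWeakDeriv_of_isPrimitive hF hm.coeFn_toLp ?_, ?_⟩
  · filter_upwards [ae_restrict_mem waveI.isOpen.measurableSet] with x hx
    rw [indicator_of_mem hx]
  · have := hasBoundaryValue_of_continuous hF.continuous hm.coeFn_toLp (-1)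
    have h0 : F (-1) = 0 := by simp [hFdef]
    rwa [h0] at this

theorem exists_hasBoundaryValue {Ω : TopologicalSpace.Opens ℝ}
    (hc : (Ω : Set ℝ).OrdConnected) (hne : (Ω : Set ℝ).Nonempty) {f g : L2 Ω}
    (h : IsWeakDeriv f g) (a : ℝ) : ∃ c, HasBoundaryValue f a c := by
  obtain ⟨F, hF, hfF⟩ := h.exists_isPrimitive hc hne
  exact ⟨_, hasBoundaryValue_of_continuous hF.continuous hfF a⟩

end WaveHeat

namespace WaveHeat

/-! ### The energy estimate -/

theorem re_inner_self_L2 {Ω : TopologicalSpace.Opens ℝ} (f : L2 Ω) :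
    (inner ℂ f f).re = ‖f‖ ^ 2 := inner_self_eq_norm_sq (𝕜 := ℂ) f

theorem inner_X (x y : X) : inner ℂ x y =
    inner ℂ (H1.fn (X.u x)) (H1.fn (X.u y)) + inner ℂ (H1.der (X.u x)) (H1.der (X.u y)) +
      inner ℂ (X.v x) (X.v y) + inner ℂ (X.w x) (X.w y) := by
  rw [WithLp.prod_inner_apply, WithLp.prod_inner_apply, Submodule.coe_inner,
    WithLp.prod_inner_apply]
  exact (add_assoc _ _ _).symm

theorem norm_sq_X (x : X) : ‖x‖ ^ 2 =
    ‖H1.fn (X.u x)‖ ^ 2 + ‖H1.der (X.u x)‖ ^ 2 + ‖X.v x‖ ^ 2 + ‖X.w x‖ ^ 2 := by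
  have hself : (inner ℂ x x).re = ‖x‖ ^ 2 := inner_self_eq_norm_sq (𝕜 := ℂ) x
  rw [← hself, inner_X]
  simp only [Complex.add_re, re_inner_self_L2]

theorem X.u_mk (u : H1 waveI) (v : L2 waveI) (w : L2 heatI) : X.u (X.mk u v w) = u := rfl

theorem X.v_mk (u : H1 waveI) (v : L2 waveI) (w : L2 heatI) : X.v (X.mk u v w) = v := rfl

theorem X.w_mk (u : H1 waveI) (v : L2 waveI) (w : L2 heatI) : X.w (X.mk u v w) = w := rfl

theorem H1.fn_mk {Ω : TopologicalSpace.Opens ℝ} {f g : L2 Ω} (h : IsWeakDeriv f g) :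
    H1.fn (H1.mk f g h) = f := rfl

theorem H1.der_mk {Ω : TopologicalSpace.Opens ℝ} {f g : L2 Ω} (h : IsWeakDeriv f g) :
    H1.der (H1.mk f g h) = g := rfl

theorem A_apply {x : X} {p q : L2 waveI} {r s : L2 heatI} (h : DomainData x p q r s) :
    A ⟨x, p, q, r, s, h⟩ = X.mk (H1.mk (X.v x) q h.v_deriv) p s :=
  funA_eq (x := ⟨x, p, q, r, s, h⟩) h

/-- The energy `‖u'‖² + ‖v‖² + ‖w‖²` decays along `A`: its derivative is `-2 ‖w'‖²`. -/
theorem DomainData.re_energy_eq {x : X} {p q : L2 waveI} {r s : L2 heatI}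
    (h : DomainData x p q r s) :
    (inner ℂ (H1.der (X.u x)) q).re + (inner ℂ (X.v x) p).re + (inner ℂ (X.w x) s).re =
      - ‖r‖ ^ 2 := by
  obtain ⟨y₀, hy₀, hr₀⟩ := h.flux
  obtain ⟨v₀, hv₀, hw₀⟩ := h.coupling
  obtain ⟨v₁, hv₁⟩ := exists_hasBoundaryValue waveI_ordConnected waveI_nonempty h.v_deriv (-1)
  have h1 := congrArg Complex.re
    (inner_add_inner_waveI h.v_deriv h.u_deriv2 hv₁ hv₀ h.neumann hy₀)
  have h2 := congrArg Complex.re (inner_add_inner_heatI h.w_deriv h.w_deriv2 hw₀ hr₀)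
  have h3 : (inner ℂ q (H1.der (X.u x))).re = (inner ℂ (H1.der (X.u x)) q).re :=
    inner_re_symm (𝕜 := ℂ) _ _
  have h6 := re_inner_self_L2 r
  simp only [mul_zero, sub_zero, Complex.add_re, Complex.neg_re] at h1 h2
  linarith

/-- In the norm of `X` the energy balance leaves the term `⟨u, v⟩`, which is bounded by
`‖x‖² / 2`. -/
theorem DomainData.re_inner_le {x : X} {p q : L2 waveI} {r s : L2 heatI}
    (h : DomainData x p q r s) :
    (inner ℂ x (X.mk (H1.mk (X.v x) q h.v_deriv) p s)).re ≤ 1 / 2 * ‖x‖ ^ 2 := by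
  have h4 : (inner ℂ (H1.fn (X.u x)) (X.v x)).re ≤ ‖H1.fn (X.u x)‖ * ‖X.v x‖ :=
    re_inner_le_norm (𝕜 := ℂ) _ _
  have h5 := h.re_energy_eq
  rw [inner_X, norm_sq_X, X.u_mk, X.v_mk, X.w_mk, H1.fn_mk, H1.der_mk]
  simp only [Complex.add_re]
  nlinarith [sq_nonneg (‖H1.fn (X.u x)‖ - ‖X.v x‖), sq_nonneg ‖r‖, sq_nonneg ‖H1.der (X.u x)‖,
    sq_nonneg ‖X.w x‖]

theorem re_inner_A_le (x : A.domain) :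
    (inner ℂ (x : X) (A x)).re ≤ 1 / 2 * ‖(x : X)‖ ^ 2 := by
  obtain ⟨x, p, q, r, s, h⟩ := x
  rw [A_apply h]
  exact h.re_inner_le

/-! ### Surjectivity of `1 - A` -/

section Restrict

variable {Ω Ω' : TopologicalSpace.Opens ℝ}

/-- Restriction `L²(Ω) → L²(Ω')` for `Ω' ⊆ Ω`. -/
noncomputable def restrictL2 (h : Ω' ≤ Ω) (f : L2 Ω) : L2 Ω' :=
  ((Lp.memLp f).mono_measure (Measure.restrict_mono h le_rfl)).toLp f

theorem coeFn_restrictL2 (h : Ω' ≤ Ω) (f : L2 Ω) :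
    restrictL2 h f =ᵐ[volume.restrict (Ω' : Set ℝ)] f := MemLp.coeFn_toLp _

theorem restrictL2_eq (h : Ω' ≤ Ω) {f : L2 Ω} {g : L2 Ω'}
    (hfg : f =ᵐ[volume.restrict (Ω' : Set ℝ)] g) : restrictL2 h f = g :=
  Lp.ext ((coeFn_restrictL2 h f).trans hfg)

theorem ae_restrict_le {P : ℝ → Prop} (h : Ω' ≤ Ω)
    (hP : ∀ᵐ x ∂volume.restrict (Ω : Set ℝ), P x) : ∀ᵐ x ∂volume.restrict (Ω' : Set ℝ), P x :=
  ae_mono (Measure.restrict_mono h le_rfl) hP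

theorem restrictL2_add (h : Ω' ≤ Ω) (f g : L2 Ω) :
    restrictL2 h (f + g) = restrictL2 h f + restrictL2 h g := by
  refine restrictL2_eq h ?_
  filter_upwards [ae_restrict_le h (Lp.coeFn_add f g), Lp.coeFn_add (restrictL2 h f)
    (restrictL2 h g), coeFn_restrictL2 h f, coeFn_restrictL2 h g] with x h1 h2 h3 h4
  rw [h1, h2, Pi.add_apply, Pi.add_apply, h3, h4]

theorem restrictL2_sub (h : Ω' ≤ Ω) (f g : L2 Ω) :
    restrictL2 h (f - g) = restrictL2 h f - restrictL2 h g := by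
  rw [eq_sub_iff_add_eq, ← restrictL2_add, sub_add_cancel]

theorem IsWeakDeriv.restrict (h : Ω' ≤ Ω) {f g : L2 Ω} (hfg : IsWeakDeriv f g) :
    IsWeakDeriv (restrictL2 h f) (restrictL2 h g) := by
  intro φ hφ hs hΩ
  have e : ∀ (f : L2 Ω) (φ : ℝ → ℝ), tsupport φ ⊆ (Ω' : Set ℝ) →
      ∫ x in (Ω' : Set ℝ), φ x • restrictL2 h f x = ∫ x in (Ω : Set ℝ), φ x • f x := by
    intro f φ hφ
    rw [setIntegral_smul_eq_integral (hφ.trans h), ← setIntegral_smul_eq_integral hφ]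
    exact integral_congr_ae ((coeFn_restrictL2 h f).mono fun x hx => by simp only [hx])
  rw [e _ _ ((tsupport_deriv_subset).trans hΩ), e _ _ hΩ]
  exact hfg φ hφ hs (hΩ.trans h)

end Restrict

/-- The half-line `(-1, ∞)`, the union of `(-1, 0)`, `(0, ∞)` and the interface `0`. -/
def bigI : TopologicalSpace.Opens ℝ := ⟨Ioi (-1), isOpen_Ioi⟩

theorem bigI_ordConnected : (bigI : Set ℝ).OrdConnected := ordConnected_Ioi
theorem bigI_nonempty : (bigI : Set ℝ).Nonempty := ⟨0, by show (-1 : ℝ) < 0; norm_num⟩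

theorem waveI_le : waveI ≤ bigI := fun _ hx => hx.1
theorem heatI_le : heatI ≤ bigI := fun x (hx : (0 : ℝ) < x) => by
  show (-1 : ℝ) < x
  linarith

/-- The function on `(-1, ∞)` equal to `g` on `(-1, 0)` and to `h` on `(0, ∞)`. -/
noncomputable def glue (g : L2 waveI) (h : L2 heatI) : L2 bigI :=
  ((((memLp_indicator_iff_restrict waveI.isOpen.measurableSet).2 (Lp.memLp g)).add
    ((memLp_indicator_iff_restrict heatI.isOpen.measurableSet).2 (Lp.memLp h))).restrict
      (bigI : Set ℝ)).toLp _

theorem coeFn_glue (g : L2 waveI) (h : L2 heatI) :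
    glue g h =ᵐ[volume.restrict (bigI : Set ℝ)]
      (waveI : Set ℝ).indicator g + (heatI : Set ℝ).indicator h := MemLp.coeFn_toLp _

theorem restrictL2_waveI_glue (g : L2 waveI) (h : L2 heatI) :
    restrictL2 waveI_le (glue g h) = g := by
  refine restrictL2_eq _ ?_
  filter_upwards [ae_restrict_le waveI_le (coeFn_glue g h),
    ae_restrict_mem waveI.isOpen.measurableSet] with x h1 h2
  have h3 : x ∉ (heatI : Set ℝ) := fun h => h2.2.not_gt h
  rw [h1, Pi.add_apply, indicator_of_mem h2, indicator_of_notMem h3, add_zero]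

theorem restrictL2_heatI_glue (g : L2 waveI) (h : L2 heatI) :
    restrictL2 heatI_le (glue g h) = h := by
  refine restrictL2_eq _ ?_
  filter_upwards [ae_restrict_le heatI_le (coeFn_glue g h),
    ae_restrict_mem heatI.isOpen.measurableSet] with x h1 h2
  have h3 : x ∉ (waveI : Set ℝ) := fun h => h.2.not_gt h2
  rw [h1, Pi.add_apply, indicator_of_mem h2, indicator_of_notMem h3, zero_add]

/-- An `H¹(-1, ∞)` function has the same boundary value at `0` from both sides. -/
theorem exists_interface_value {f g : L2 bigI} (h : IsWeakDeriv f g) :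
    ∃ c, HasBoundaryValue (restrictL2 waveI_le f) 0 c ∧
      HasBoundaryValue (restrictL2 heatI_le f) 0 c := by
  obtain ⟨F, hF, hfF⟩ := h.exists_isPrimitive bigI_ordConnected bigI_nonempty
  exact ⟨F 0, hasBoundaryValue_of_continuous hF.continuous
      ((coeFn_restrictL2 _ f).trans (ae_restrict_le waveI_le hfF)) 0,
    hasBoundaryValue_of_continuous hF.continuous
      ((coeFn_restrictL2 _ f).trans (ae_restrict_le heatI_le hfF)) 0⟩

/-- The projection onto `H¹(Ω)` in `L²(Ω) × L²(Ω)` solves the variational problem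
`⟨φ, z - k⟩ + ⟨φ', z' + m⟩ = 0` for all `φ ∈ H¹(Ω)`. -/
theorem exists_variational_solution {Ω : TopologicalSpace.Opens ℝ} (k m : L2 Ω) :
    ∃ z z' : L2 Ω, IsWeakDeriv z z' ∧ ∀ φ φ', IsWeakDeriv φ φ' →
      inner ℂ φ (z - k) + inner ℂ φ' (z' + m) = 0 := by
  set a : WithLp 2 (L2 Ω × L2 Ω) := WithLp.toLp 2 (k, -m) with ha
  set z := (H1 Ω).starProjection a with hz
  have hmem : z ∈ H1 Ω := Submodule.starProjection_apply_mem _ _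
  refine ⟨z.fst, z.snd, hmem, fun φ φ' hφ => ?_⟩
  have h1 := (Submodule.mem_orthogonal _ _).1
    (Submodule.sub_starProjection_mem_orthogonal (K := H1 Ω) a) (WithLp.toLp 2 (φ, φ')) hφ
  rw [WithLp.prod_inner_apply] at h1
  have h2 : inner ℂ φ (k - z.fst) + inner ℂ φ' (-m - z.snd) = 0 := h1
  have h3 : z.fst - k = -(k - z.fst) := by abel
  have h4 : z.snd + m = -(-m - z.snd) := by abel
  rw [h3, h4, inner_neg_right, inner_neg_right, ← neg_add, h2, neg_zero]

theorem exists_test_at_neg_one : ∃ φ : ℝ → ℝ, ContDiff ℝ ∞ φ ∧ HasCompactSupport φ ∧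
    φ (-1) = 1 ∧ ∀ x, -(1 / 2) < x → φ x = 0 := by
  let β : ContDiffBump (-1 : ℝ) := ⟨1 / 4, 1 / 2, by norm_num, by norm_num⟩
  refine ⟨β, β.contDiff, β.hasCompactSupport, ?_, fun x hx => ?_⟩
  · exact β.one_of_mem_closedBall (by simp [β])
  · refine β.zero_of_le_dist ?_
    rw [Real.dist_eq]
    refine le_trans ?_ (le_abs_self _)
    show (1 / 2 : ℝ) ≤ x - -1
    linarith

/-- The natural boundary condition at `-1` in the variational problem. -/
theorem hasBoundaryValue_neg_one_of_variational {P p : L2 bigI} (hp : IsWeakDeriv p P)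
    (h : ∀ φ φ', IsWeakDeriv φ φ' → inner ℂ φ P + inner ℂ φ' p = 0) :
    HasBoundaryValue (restrictL2 waveI_le p) (-1) 0 := by
  obtain ⟨φ, hφ, hs, hφ1, hφ0⟩ := exists_test_at_neg_one
  have hd : Continuous (deriv φ) := hφ.continuous_deriv (by simp)
  have hdφ0 : ∀ x, -(1 / 2) < x → deriv φ x = 0 := fun x hx => by
    have : φ =ᶠ[𝓝 x] fun _ => 0 := by
      filter_upwards [lt_mem_nhds hx] with y hy using hφ0 y hy
    rw [this.deriv_eq, deriv_const]
  have e : ∀ (f : L2 bigI) (ψ : ℝ → ℝ) (hψ : Continuous ψ) (hψs : HasCompactSupport ψ),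
      (∀ x, -(1 / 2) < x → ψ x = 0) →
      inner ℂ (testL2 bigI hψ hψs) f = inner ℂ (testL2 waveI hψ hψs) (restrictL2 waveI_le f) := by
    intro f ψ hψ hψs h0
    rw [inner_testL2, inner_testL2, setIntegral_eq_of_subset_of_forall_sdiff_eq_zero
      bigI.isOpen.measurableSet waveI_le]
    · exact integral_congr_ae ((coeFn_restrictL2 waveI_le f).mono fun x hx => by simp only [hx])
    · intro x hx
      rw [h0 x ?_, zero_smul]
      by_contra hlt
      exact hx.2 ⟨hx.1, by linarith⟩
  have h1 := h _ _ (isWeakDeriv_testL2 (Ω := bigI) hφ hs)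
  rw [e _ _ _ _ hφ0, e _ _ _ _ hdφ0] at h1
  have hp' := hp.restrict waveI_le
  obtain ⟨c₀, hc₀⟩ := exists_hasBoundaryValue waveI_ordConnected waveI_nonempty hp' (-1)
  obtain ⟨c₁, hc₁⟩ := exists_hasBoundaryValue waveI_ordConnected waveI_nonempty hp' 0
  have h2 := inner_add_inner_waveI (isWeakDeriv_testL2 hφ hs) hp'
    (hasBoundaryValue_testL2 _ _ _) (hasBoundaryValue_testL2 _ _ _) hc₀ hc₁
  rw [add_comm, h1, hφ1, hφ0 0 (by norm_num)] at h2
  have h3 : c₀ = 0 := by simpa using h2.symm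
  rwa [h3] at hc₀

/-- `1 - A` is onto. On `(-1, ∞)` the pair `(v, w)` is the solution `z` of the variational
problem, and `(u', w')` is the flux `z' + (f', 0)`, which lies in `H¹(-1, ∞)`. -/
theorem exists_sub_A_eq (y : X) : ∃ x : A.domain, ((1 : ℝ) : ℂ) • (x : X) - A x = y := by
  obtain ⟨z, z', hz, hvar⟩ := exists_variational_solution (Ω := bigI)
    (glue (X.v y) (X.w y)) (glue (H1.der (X.u y)) 0)
  have hflux : IsWeakDeriv (z' + glue (H1.der (X.u y)) 0) (z - glue (X.v y) (X.w y)) :=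
    isWeakDeriv_iff_inner.2 fun φ hφ hs _ => by
      rw [add_comm]; exact hvar _ _ (isWeakDeriv_testL2 hφ hs)
  have hwave := hflux.restrict waveI_le
  have hheat := hflux.restrict heatI_le
  have hn := hasBoundaryValue_neg_one_of_variational hflux hvar
  obtain ⟨c, hc1, hc2⟩ := exists_interface_value hflux
  rw [restrictL2_add, restrictL2_waveI_glue] at hn hc1
  rw [restrictL2_add, restrictL2_heatI_glue, add_zero] at hc2
  rw [restrictL2_add, restrictL2_sub, restrictL2_waveI_glue, restrictL2_waveI_glue] at hwave
  rw [restrictL2_add, restrictL2_sub, restrictL2_heatI_glue, restrictL2_heatI_glue,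
    add_zero] at hheat
  have hv := hz.restrict waveI_le
  have hw := hz.restrict heatI_le
  have hdata : DomainData
      (X.mk (H1.mk _ _ hv + X.u y) (restrictL2 waveI_le z) (restrictL2 heatI_le z))
      (restrictL2 waveI_le z - X.v y) (restrictL2 waveI_le z')
      (restrictL2 heatI_le z') (restrictL2 heatI_le z - X.w y) :=
    ⟨hwave, hv, hw, hheat, hn, ⟨c, hc1, hc2⟩, exists_interface_value hz⟩
  refine ⟨⟨_, _, _, _, _, hdata⟩, ?_⟩
  rw [A_apply hdata, Complex.ofReal_one, one_smul, sub_eq_iff_eq_add]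
  show X.mk (H1.mk _ _ hv + X.u y) (restrictL2 waveI_le z) (restrictL2 heatI_le z) =
    X.mk (X.u y) (X.v y) (X.w y) + X.mk (H1.mk _ _ hv) (restrictL2 waveI_le z - X.v y)
      (restrictL2 heatI_le z - X.w y)
  rw [X.mk_add]
  congr 1
  · exact add_comm _ _
  · rw [add_sub_cancel]
  · rw [add_sub_cancel]

end WaveHeat

namespace WaveHeat

/-! ### The kernel of `A` -/

theorem mem_pmapKer_A {x : X} : x ∈ pmapKer A ↔ ∃ h : x ∈ A.domain, A ⟨x, h⟩ = 0 := by
  constructor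
  · rintro ⟨⟨x, h⟩, hx, rfl⟩
    exact ⟨h, hx⟩
  · rintro ⟨h, hx⟩
    exact ⟨⟨x, h⟩, hx, rfl⟩

theorem X.ext_components {x y : X} (hu : X.u x = X.u y) (hv : X.v x = X.v y) (hw : X.w x = X.w y) :
    x = y := by
  show X.mk (X.u x) (X.v x) (X.w x) = X.mk (X.u y) (X.v y) (X.w y)
  rw [hu, hv, hw]

theorem H1.ext_fn_der {Ω : TopologicalSpace.Opens ℝ} {u v : H1 Ω} (h : H1.fn u = H1.fn v)
    (h' : H1.der u = H1.der v) : u = v := by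
  show H1.mk (H1.fn u) (H1.der u) u.2 = H1.mk (H1.fn v) (H1.der v) v.2
  exact H1.mk_congr h h' _ _

theorem X.v_zero : X.v 0 = 0 := rfl

theorem X.w_zero : X.w 0 = 0 := rfl

theorem fn_u_zero : H1.fn (X.u 0) = 0 := rfl

theorem der_u_zero : H1.der (X.u 0) = 0 := rfl

theorem domainData_one : DomainData (X.mk oneH1 0 0) 0 0 0 0 :=
  ⟨IsWeakDeriv.zero, IsWeakDeriv.zero, IsWeakDeriv.zero, IsWeakDeriv.zero,
    HasBoundaryValue.zero, ⟨0, HasBoundaryValue.zero, HasBoundaryValue.zero⟩,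
    ⟨0, HasBoundaryValue.zero, HasBoundaryValue.zero⟩⟩

theorem A_one : A ⟨X.mk oneH1 0 0, _, _, _, _, domainData_one⟩ = 0 := by
  rw [A_apply domainData_one]
  refine X.ext_components (H1.ext_fn_der ?_ ?_) ?_ ?_
  · rw [X.u_mk, H1.fn_mk, X.v_mk, fn_u_zero]
  · rw [X.u_mk, H1.der_mk, der_u_zero]
  · rw [X.v_mk, X.v_zero]
  · rw [X.w_mk, X.w_zero]

theorem pmapKer_A : pmapKer A = Submodule.span ℂ {X.mk oneH1 0 0} := by
  apply le_antisymm
  · intro x hx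
    obtain ⟨⟨p, q, r, s, h⟩, hAx⟩ := mem_pmapKer_A.1 hx
    have hAx' : X.mk (H1.mk (X.v x) q h.v_deriv) p s = 0 := (A_apply h).symm.trans hAx
    have hv : X.v x = 0 := by
      have := congrArg (fun y => H1.fn (X.u y)) hAx'
      rwa [X.u_mk, H1.fn_mk, fn_u_zero] at this
    have hp : p = 0 := by
      have := congrArg X.v hAx'
      rwa [X.v_mk, X.v_zero] at this
    have hs : s = 0 := by
      have := congrArg X.w hAx'
      rwa [X.w_mk, X.w_zero] at this
    have hr : r = 0 := eq_zero_of_isWeakDeriv_zero_heatI (hs ▸ h.w_deriv2)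
    have hw : X.w x = 0 := eq_zero_of_isWeakDeriv_zero_heatI (hr ▸ h.w_deriv)
    obtain ⟨c, hc, hcb⟩ := exists_eq_smul_oneL2_of_isWeakDeriv_zero (hp ▸ h.u_deriv2)
    have hc0 : c = 0 := (hcb (-1)).unique neg_one_mem_closure_waveI h.neumann
    rw [hc0, zero_smul] at hc
    have hu : IsWeakDeriv (H1.fn (X.u x)) (H1.der (X.u x)) := (X.u x).2
    obtain ⟨d, hd, -⟩ := exists_eq_smul_oneL2_of_isWeakDeriv_zero (hc ▸ hu)
    refine Submodule.mem_span_singleton.2 ⟨d, X.ext_components (H1.ext_fn_der hd.symm ?_) ?_ ?_⟩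
    · rw [hc]; exact smul_zero d
    · rw [hv]; exact smul_zero d
    · rw [hw]; exact smul_zero d
  · rw [Submodule.span_singleton_le_iff_mem, mem_pmapKer_A]
    exact ⟨_, A_one⟩

theorem one_ne_zero_X : X.mk oneH1 0 0 ≠ 0 := by
  intro h
  have h1 : oneL2 = 0 := congrArg (fun y => H1.fn (X.u y)) h
  have h2 : (fun _ : ℝ => (1 : ℂ)) =ᵐ[volume.restrict (waveI : Set ℝ)] fun _ => 0 := by
    filter_upwards [memLp_one.coeFn_toLp, Lp.coeFn_zero ℂ 2 (volume.restrict (waveI : Set ℝ))]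
      with x h3 h4
    rw [← h3, ← oneL2, h1, h4]; rfl
  obtain ⟨x, hx⟩ := waveI_nonempty
  exact one_ne_zero (Measure.eqOn_open_of_ae_eq h2 waveI.isOpen continuousOn_const
    continuousOn_const hx)

/-! ### The range of `A` -/

theorem exists_test_heatI : ∃ χ : ℝ → ℝ, ContDiff ℝ ∞ χ ∧ HasCompactSupport χ ∧
    χ 0 = 1 ∧ deriv χ 0 = 0 := by
  let β : ContDiffBump (0 : ℝ) := ⟨1, 2, by norm_num, by norm_num⟩
  refine ⟨β, β.contDiff, β.hasCompactSupport, β.one_of_mem_closedBall (by simp [β]), ?_⟩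
  have : (β : ℝ → ℝ) =ᶠ[𝓝 0] fun _ => 1 := β.eventuallyEq_one
  rw [this.deriv_eq, deriv_const]

/-- There are `H²(0, ∞)` functions with arbitrary value and slope at `0`. -/
theorem exists_heatI_value_slope (α β : ℂ) : ∃ w r s : L2 heatI, IsWeakDeriv w r ∧
    IsWeakDeriv r s ∧ HasBoundaryValue w 0 α ∧ HasBoundaryValue r 0 β := by
  obtain ⟨χ, hχ, hs, h1, h2⟩ := exists_test_heatI
  have hχd : ContDiff ℝ ∞ (deriv χ) := (contDiff_infty_iff_deriv.1 hχ).2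
  have hη : ContDiff ℝ ∞ fun x => x * χ x := contDiff_id.mul hχ
  have hηs : HasCompactSupport fun x => x * χ x := hs.mul_left
  have hηd : ContDiff ℝ ∞ (deriv fun x => x * χ x) := (contDiff_infty_iff_deriv.1 hη).2
  have h3 : deriv (fun x => x * χ x) 0 = 1 := by
    have := ((hasDerivAt_id (0 : ℝ)).mul (hχ.differentiable (by simp) 0).hasDerivAt).deriv
    simpa [h1, h2] using! this
  refine ⟨_, _, _,
    ((isWeakDeriv_testL2 hχ hs).smul α).add ((isWeakDeriv_testL2 hη hηs).smul β),
    ((isWeakDeriv_testL2 hχd hs.deriv).smul α).add ((isWeakDeriv_testL2 hηd hηs.deriv).smul β),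
    ?_, ?_⟩
  · have := ((hasBoundaryValue_testL2 (Ω := heatI) hχ.continuous hs 0).smul α).add
      ((hasBoundaryValue_testL2 (Ω := heatI) hη.continuous hηs 0).smul β)
    simpa [h1] using this
  · have := ((hasBoundaryValue_testL2 (Ω := heatI) hχd.continuous hs.deriv 0).smul α).add
      ((hasBoundaryValue_testL2 (Ω := heatI) hηd.continuous hηs.deriv 0).smul β)
    simpa [h2, h3] using this

theorem DomainData.inner_eq_zero {x y : X} {p q : L2 waveI} {r s : L2 heatI}
    (h : DomainData x p q r s) (hy : y ∈ (pmapRan A)ᗮ) :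
    inner ℂ (X.v x) (H1.fn (X.u y)) + inner ℂ q (H1.der (X.u y)) + inner ℂ p (X.v y) +
      inner ℂ s (X.w y) = 0 := by
  have h1 := (Submodule.mem_orthogonal _ _).1 hy _ ⟨⟨x, p, q, r, s, h⟩, A_apply h⟩
  rwa [inner_X, X.u_mk, X.v_mk, X.w_mk, H1.fn_mk, H1.der_mk] at h1

theorem w_eq_zero_of_mem_orthogonal {y : X} (hy : y ∈ (pmapRan A)ᗮ) : X.w y = 0 := by
  refine eq_zero_of_integral_deriv2_smul_eq_zero fun φ hφ hs hΩ => ?_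
  have hd : ContDiff ℝ ∞ (deriv φ) := (contDiff_infty_iff_deriv.1 hφ).2
  have h0 : (0 : ℝ) ∉ tsupport φ := fun h => lt_irrefl (0 : ℝ) (hΩ h)
  have b1 := hasBoundaryValue_testL2 (Ω := heatI) hφ.continuous hs 0
  have b2 := hasBoundaryValue_testL2 (Ω := heatI) hd.continuous hs.deriv 0
  rw [image_eq_zero_of_notMem_tsupport h0, Complex.ofReal_zero] at b1
  rw [image_eq_zero_of_notMem_tsupport fun h => h0 (tsupport_deriv_subset h),
    Complex.ofReal_zero] at b2
  have hdata : DomainData (X.mk 0 0 (testL2 heatI hφ.continuous hs)) 0 0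
      (testL2 heatI hd.continuous hs.deriv)
      (testL2 heatI (hd.continuous_deriv (by simp)) hs.deriv.deriv) :=
    ⟨IsWeakDeriv.zero, IsWeakDeriv.zero, isWeakDeriv_testL2 hφ hs,
      isWeakDeriv_testL2 hd hs.deriv, HasBoundaryValue.zero,
      ⟨0, HasBoundaryValue.zero, b2⟩, ⟨0, HasBoundaryValue.zero, b1⟩⟩
  have h1 := hdata.inner_eq_zero hy
  rw [X.v_mk, inner_zero_left, inner_zero_left, inner_zero_left, zero_add, zero_add, zero_add,
    inner_testL2] at h1
  exact h1

/-- In `D(A)` the components `v` and `u''` are arbitrary: the heat profile can be adjusted to any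
values of `v(0)` and `u'(0)`. -/
theorem exists_domainData_of_isWeakDeriv {v q p : L2 waveI} (hv : IsWeakDeriv v q) :
    ∃ (x : X) (r s : L2 heatI), X.v x = v ∧ DomainData x p q r s := by
  obtain ⟨y, hy, hy0⟩ := exists_isWeakDeriv_waveI p
  obtain ⟨u, hu, -⟩ := exists_isWeakDeriv_waveI y
  obtain ⟨α, hα⟩ := exists_hasBoundaryValue waveI_ordConnected waveI_nonempty hv 0
  obtain ⟨β, hβ⟩ := exists_hasBoundaryValue waveI_ordConnected waveI_nonempty hy 0
  obtain ⟨w, r, s, hw, hr, hwα, hrβ⟩ := exists_heatI_value_slope α β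
  exact ⟨X.mk (H1.mk u y hu) v w, r, s, rfl,
    ⟨hy, hv, hw, hr, hy0, ⟨β, hβ, hrβ⟩, ⟨α, hα, hwα⟩⟩⟩

theorem dense_pmapRan_A : Dense (pmapRan A : Set X) := by
  rw [Submodule.dense_iff_topologicalClosure_eq_top, Submodule.topologicalClosure_eq_top_iff,
    Submodule.eq_bot_iff]
  intro y hy
  have hw := w_eq_zero_of_mem_orthogonal hy
  have hv : X.v y = 0 := by
    obtain ⟨x, r, s, hx, hdata⟩ := exists_domainData_of_isWeakDeriv (p := X.v y) IsWeakDeriv.zero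
    have h1 := hdata.inner_eq_zero hy
    rw [hx, hw, inner_zero_left, inner_zero_left, inner_zero_right, zero_add, zero_add,
      add_zero] at h1
    exact inner_self_eq_zero.1 h1
  have hu : IsWeakDeriv (H1.fn (X.u y)) (H1.der (X.u y)) := (X.u y).2
  obtain ⟨x, r, s, hx, hdata⟩ := exists_domainData_of_isWeakDeriv (p := 0) hu
  have h1 := hdata.inner_eq_zero hy
  have h2 := inner_X y y
  rw [hx, inner_zero_left, hw, inner_zero_right, add_zero, add_zero] at h1
  rw [h1, hv, hw, inner_zero_right, inner_zero_right, add_zero, add_zero] at h2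
  exact inner_self_eq_zero.1 h2

end WaveHeat

/-! ### Generation, unboundedness and failure of the splitting -/

theorem corollary5p3 :
    (∃ T : C0Semigroup WaveHeat.X, T.generator = WaveHeat.A) ∧
    (∀ T : C0Semigroup WaveHeat.X, T.generator = WaveHeat.A → ¬ T.IsBounded) ∧
    WaveHeat.pmapKer WaveHeat.A =
      Submodule.span ℂ {WaveHeat.X.mk WaveHeat.oneH1 0 0} ∧
    Dense (WaveHeat.pmapRan WaveHeat.A : Set WaveHeat.X) ∧
    ¬ IsCompl (WaveHeat.pmapRan WaveHeat.A).topologicalClosure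
        (WaveHeat.pmapKer WaveHeat.A) := by
  refine ⟨LinearPMap.exists_c0Semigroup WaveHeat.re_inner_A_le (by norm_num)
      WaveHeat.exists_sub_A_eq, fun T hT hb => ?_, WaveHeat.pmapKer_A,
    WaveHeat.dense_pmapRan_A, fun h => ?_⟩
  · have hgen : ∀ x : WaveHeat.A.domain, T.HasGenValue x (WaveHeat.A x) := by
      rw [← hT]
      exact T.hasGenValue_generator
    have h0 := hgen ⟨_, _, _, _, _, WaveHeat.domainData_one⟩
    rw [WaveHeat.A_one] at h0
    refine WaveHeat.one_ne_zero_X (C0Semigroup.eq_zero_of_hasGenValue_zero hb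
      (WaveHeat.dense_pmapRan_A.mono ?_) h0)
    rintro _ ⟨x, rfl⟩
    exact ⟨x, hgen x⟩
  · have h1 := h.disjoint
    rw [(Submodule.dense_iff_topologicalClosure_eq_top).1 WaveHeat.dense_pmapRan_A,
      top_disjoint, WaveHeat.pmapKer_A, Submodule.span_singleton_eq_bot] at h1
    exact WaveHeat.one_ne_zero_X h1
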